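/- **Setting (bandit with missing outcomes, no mediator).** There are $n$ arms. Pulling arm $a$ draws, independently of the past, a pair $(Y,O)\in\mathbb{R}\times\{0,1\}$ from a fixed law attached to $a$, with $O$ independent of $Y$ given the arm, $\mathbb{P}(O=1\mid a)=\gamma_a\in(0,1]$, mean $\mu_a=\mathbb{E}[Y\mid a]\in[0,1]$, and $Y-\mu_a$ sub-Gaussian with variance proxy $1$, i.e. $\mathbb{E}[e^{\lambda(Y-\mu_a)}\mid a]\le e^{\lambda^2/2}$ for all $\lambda\in\mathbb{R}$. Call such a collection of laws a $\gamma$-instance. The agent sees $O$, and sees $Y$ only when $O=1$. A policy $\pi$ chooses each arm (possibly at random) from the observed history. The regret over $T$ rounds is $R_T(\pi,\nu)=\sum_{t=1}^T(\max_b\mu_b-\mu_{a_t})$. Put $$S=\frac1n\sum_a\frac1{\gamma_a},\qquad H=\frac{n}{\sum_a\gamma_a}.$$ **Algorithm** (parameters $\alpha$ and horizon $T$; the UCB algorithm for outcomes missing at random with unknown mediator probabilities). It is defined for a finite set $\mathcal M$ of fully observed mediator values. First each arm is pulled $\lceil\log(T)^2\rceil$ times, one arm after the other. In every later round it pulls an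 arm maximizing $$\mathrm{UCB}_a=\hat\mu_a+8\sqrt{\frac{\alpha\log T}{2}\sum_{m\in\mathcal M}\frac{\hat p_{m,a}^2}{T_{m,a,o}}},$$ with ties broken arbitrarily. Here $T_a$ is the number of pulls of $a$ so far, $\hat p_{m,a}$ is the fraction of these with mediator value $m$, $T_{m,a,o}$ is the number of these with mediator value $m$ and observed outcome, $\hat\mu_{m,a}$ is the average of those observed outcomes ($0$ if there are none), and $\hat\mu_a=\frac1{T_a}\sum_{s:\,a_s=a}\hat\mu_{m_s,a}$, where $m_s$ is the mediator value seen in round $s$. (A summand with $T_{m,a,o}=0$ is $+\infty$ if $\hat p_{m,a}>0$ and $0$ if $\hat p_{m,a}=0$.) Without a mediator, $|\mathcal M|=1$. **Corollary.** 1. There is a universal constant $C$ such that for all $n\ge1$, all $\gamma\in(0,1]^n$ and all $\alpha>1$ there is $T_0=T_0(n,\gamma,\alpha)$ such that for every $T\ge T_0$ and every $\gamma$-instance $\nu$, the algorithm $\pi$ with $|\mathcal M|=1$ satisfies $$\mathbb{E}[R_T(\pi,\nu)]\le C\sqrt{\alpha\,T\log(T)\,n\,S}.$$ 2. There is a universal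 constant $c>0$ such that for all $n\ge2$, all $\gamma\in(0,1]^n$, all $T\ge nH$ and every policy $\pi$ there is a $\gamma$-instance $\nu$ with $$\mathbb{E}[R_T(\pi,\nu)]\ge c\sqrt{T\,n\,H}.$$ -/

import Mathlib

open MeasureTheory ProbabilityTheory
open scoped ENNReal

noncomputable section

namespace MissingBandit

/-- What the agent sees of one draw: the mediator, and the observed outcome `Y^o`, which is
`Sum.inl y` when the outcome `y` is observed and `Sum.inr ()` (the symbol `?`) when it is missing. -/
abbrev Obs (M : Type) : Type := M × (ℝ ⊕ Unit)

/-- The observed history after `t` rounds: the arms pulled and what was seen after each pull. -/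
abbrev Hist (n : ℕ) (M : Type) (t : ℕ) : Type := Fin t → Fin n × Obs M

/-- The observed part of a full draw `(Y, O, M)`, where `O` tells whether `Y` is observed. -/
def observe {M : Type} (z : ℝ × Bool × M) : Obs M :=
  (z.2.2, if z.2.1 = true then Sum.inl z.1 else Sum.inr ())

/-- A bandit instance with `n` arms, fully observed mediator in `M`, and possibly missing outcomes:
`law a` is the joint law of `(Y, O, M)` when arm `a` is pulled. -/
structure Instance (n : ℕ) (M : Type) [MeasurableSpace M] where
  law : Fin n → Measure (ℝ × Bool × M)
  isProb : ∀ a, IsProbabilityMeasure (law a)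

/-- A (possibly randomized) policy: a conditional law of the next arm given the observed history. -/
structure Policy (n : ℕ) (M : Type) [MeasurableSpace M] where
  kernel : (t : ℕ) → Kernel (Hist n M t) (Fin n)
  isMarkov : ∀ t, IsMarkovKernel (kernel t)

section Interaction

variable {n : ℕ} {M : Type} [MeasurableSpace M]

theorem measurable_observe : Measurable (observe (M := M)) := by
  refine Measurable.prodMk (by fun_prop) ?_
  refine Measurable.ite ?_ (by fun_prop) measurable_const
  exact measurable_snd.fst (measurableSet_singleton true)

/-- The mean outcome `μ_a` of arm `a` (over all draws, observed or not). -/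
def Instance.mean (ν : Instance n M) (a : Fin n) : ℝ := ∫ z, z.1 ∂(ν.law a)

/-- Arm `a` ↦ law of what the agent sees when pulling `a`. -/
def Instance.obsKernel (ν : Instance n M) : Kernel (Fin n) (Obs M) where
  toFun a := (ν.law a).map observe
  measurable' := measurable_of_countable _

instance (ν : Instance n M) : IsMarkovKernel ν.obsKernel :=
  ⟨fun a => by
    have := ν.isProb a
    exact Measure.isProbabilityMeasure_map measurable_observe.aemeasurable⟩

instance (π : Policy n M) (t : ℕ) : IsMarkovKernel (π.kernel t) := π.isMarkov t

/-- One round: the policy picks an arm given the history, then the environment responds,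
its response depending on the history through the arm only. -/
def stepKernel (π : Policy n M) (ν : Instance n M) (t : ℕ) :
    Kernel (Hist n M t) (Fin n × Obs M) :=
  (π.kernel t) ⊗ₖ (Kernel.prodMkLeft (Hist n M t) ν.obsKernel)

instance (π : Policy n M) (ν : Instance n M) (t : ℕ) : IsMarkovKernel (stepKernel π ν t) := by
  unfold stepKernel; infer_instance

/-- Append one round to a history. -/
def extend {t : ℕ} (p : Hist n M t × (Fin n × Obs M)) : Hist n M (t + 1) :=
  Fin.snoc (α := fun _ => Fin n × Obs M) p.1 p.2

theorem measurable_extend {t : ℕ} : Measurable (extend (n := n) (M := M) (t := t)) := by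
  refine measurable_pi_lambda _ fun i => ?_
  induction i using Fin.lastCases with
  | last => simpa [extend] using measurable_snd
  | cast i =>
    have : Measurable fun p : Hist n M t × (Fin n × Obs M) => p.1 i :=
      (measurable_pi_apply i).comp measurable_fst
    simpa [extend] using this

/-- The law of the observed history after `t` rounds of `π` interacting with `ν`. -/
def histLaw (π : Policy n M) (ν : Instance n M) : (t : ℕ) → Measure (Hist n M t)
  | 0 => Measure.dirac Fin.elim0
  | t + 1 => ((histLaw π ν t) ⊗ₘ (stepKernel π ν t)).map extend

instance (π : Policy n M) (ν : Instance n M) (t : ℕ) : IsProbabilityMeasure (histLaw π ν t) := by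
  induction t with
  | zero => unfold histLaw; infer_instance
  | succ t ih =>
    unfold histLaw
    exact Measure.isProbabilityMeasure_map measurable_extend.aemeasurable

/-- The expected cumulative regret over `T` rounds:
`E[∑ t, (max_b μ_b - μ_{a_t})]`. -/
def expectedRegret (π : Policy n M) (ν : Instance n M) (T : ℕ) : ℝ :=
  ∫ h, ∑ t : Fin T, ((⨆ b, ν.mean b) - ν.mean (h t).1) ∂(histLaw π ν T)

theorem measurableSet_arm {t : ℕ} (s : Fin t) (a : Fin n) :
    MeasurableSet {h : Hist n M t | (h s).1 = a} :=
  (measurable_pi_apply s).fst (measurableSet_singleton a)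

theorem measurableSet_med [MeasurableSingletonClass M] {t : ℕ} (s : Fin t) (m : M) :
    MeasurableSet {h : Hist n M t | (h s).2.1 = m} :=
  (measurable_pi_apply s).snd.fst (measurableSet_singleton m)

theorem measurableSet_observed {t : ℕ} (s : Fin t) :
    MeasurableSet {h : Hist n M t | (h s).2.2.isLeft = true} := by
  have h1 : MeasurableSet {x : ℝ ⊕ Unit | x.isLeft = true} := by
    rw [measurableSet_sum_iff]
    constructor <;> simp
  exact (measurable_pi_apply s).snd.snd h1

end Interaction

section Algorithm

variable {n : ℕ} {M : Type} [Fintype M] [DecidableEq M] {t : ℕ}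

/-- `T_a`: the number of pulls of arm `a`. -/
def pulls (h : Hist n M t) (a : Fin n) : ℕ :=
  ∑ s, if (h s).1 = a then 1 else 0

/-- `s_{m,a}`: the number of pulls of arm `a` with mediator value `m`. -/
def medCount (h : Hist n M t) (m : M) (a : Fin n) : ℕ :=
  ∑ s, if (h s).1 = a ∧ (h s).2.1 = m then 1 else 0

/-- `T_{m,a,o}`: the number of pulls of arm `a` with mediator value `m` and observed outcome. -/
def obsCount (h : Hist n M t) (m : M) (a : Fin n) : ℕ :=
  ∑ s, if (h s).1 = a ∧ (h s).2.1 = m ∧ (h s).2.2.isLeft = true then 1 else 0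

/-- `μ̂_{m,a}`: the average of the outcomes observed on arm `a` with mediator value `m`
(its initial value `0` if there are none). -/
def muHatMed (h : Hist n M t) (m : M) (a : Fin n) : ℝ :=
  (∑ s, if (h s).1 = a ∧ (h s).2.1 = m then Sum.elim id (fun _ => 0) (h s).2.2 else 0)
    / (obsCount h m a : ℝ)

/-- `p̂_{m,a} = s_{m,a} / T_a`. -/
def pHat (h : Hist n M t) (m : M) (a : Fin n) : ℝ :=
  (medCount h m a : ℝ) / (pulls h a : ℝ)

/-- `μ̂_a = (1 / T_a) ∑_s ∑_m μ̂_{m,a} 1{M_s = m}`, over the rounds `s` in which `a` was pulled. -/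
def muHat (h : Hist n M t) (a : Fin n) : ℝ :=
  (∑ s, if (h s).1 = a then ∑ m, muHatMed h m a * (if (h s).2.1 = m then 1 else 0) else 0)
    / (pulls h a : ℝ)

/-- `UCB_a = μ̂_a + 8 √((α log T / 2) ∑_m p̂_{m,a}² / T_{m,a,o})`. The width is computed in `[0, ∞]`,
so that it is infinite when `T_{m,a,o} = 0` for some mediator value seen with arm `a`
(provided `log T > 0`). -/
def ucb (α : ℝ) (T : ℕ) (h : Hist n M t) (a : Fin n) : EReal :=
  (muHat h a : EReal) +
    ((8 * (ENNReal.ofReal (α * Real.log T / 2) *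
      ∑ m, ENNReal.ofReal (pHat h m a ^ 2) / (obsCount h m a : ℝ≥0∞)) ^ (1 / 2 : ℝ) : ℝ≥0∞) : EReal)

/-- The number `⌈log(T)²⌉` of initial pulls of each arm. -/
def initPulls (T : ℕ) : ℕ := ⌈Real.log T ^ 2⌉₊

/-- The policy `π` runs, over horizon `T` and with exploration parameter `α`, the UCB algorithm for
outcomes missing at random with unknown mediator probabilities: first every arm is pulled
`initPulls T` times, one arm after the other; afterwards an arm of maximal index is pulled,
ties being broken in any way. -/
def IsMARAlgorithm [MeasurableSpace M] (α : ℝ) (T : ℕ) (π : Policy n M) : Prop :=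
  ∀ t < T, ∀ h : Hist n M t, ∀ᵐ a : Fin n ∂(π.kernel t h),
    if t < n * initPulls T then (a : ℕ) = t / initPulls T
    else ∀ b, ucb α T h b ≤ ucb α T h a

section Existence

variable [MeasurableSpace M] [MeasurableSingletonClass M]

theorem measurable_ucb (α : ℝ) (T : ℕ) (a : Fin n) :
    Measurable (fun h : Hist n M t => ucb α T h a) := by
  have hp : Measurable (fun h : Hist n M t => pulls h a) :=
    Finset.measurable_sum _ fun s _ =>
      Measurable.ite (measurableSet_arm s a) measurable_const measurable_const
  have hm (m : M) : Measurable (fun h : Hist n M t => medCount h m a) :=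
    Finset.measurable_sum _ fun s _ =>
      Measurable.ite ((measurableSet_arm s a).inter (measurableSet_med s m))
        measurable_const measurable_const
  have ho (m : M) : Measurable (fun h : Hist n M t => obsCount h m a) :=
    Finset.measurable_sum _ fun s _ =>
      Measurable.ite ((measurableSet_arm s a).inter
        ((measurableSet_med s m).inter (measurableSet_observed s)))
        measurable_const measurable_const
  have hc : Measurable (fun k : ℕ => (k : ℝ)) := measurable_of_countable _
  have hc' : Measurable (fun k : ℕ => (k : ℝ≥0∞)) := measurable_of_countable _
  have hmu (m : M) : Measurable (fun h : Hist n M t => muHatMed h m a) := by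
    refine Measurable.div (Finset.measurable_sum _ fun s _ => ?_) (hc.comp (ho m))
    refine Measurable.ite ((measurableSet_arm s a).inter (measurableSet_med s m)) ?_
      measurable_const
    exact (measurable_id.sumElim measurable_const).comp (measurable_pi_apply s).snd.snd
  have hph (m : M) : Measurable (fun h : Hist n M t => pHat h m a) :=
    (hc.comp (hm m)).div (hc.comp hp)
  have hmuA : Measurable (fun h : Hist n M t => muHat h a) := by
    refine Measurable.div (Finset.measurable_sum _ fun s _ => ?_) (hc.comp hp)
    refine Measurable.ite (measurableSet_arm s a) ?_ measurable_const
    refine Finset.measurable_sum _ fun m _ => (hmu m).mul ?_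
    exact Measurable.ite (measurableSet_med s m) measurable_const measurable_const
  have hw : Measurable (fun h : Hist n M t => ((8 * (ENNReal.ofReal (α * Real.log T / 2) *
      ∑ m, ENNReal.ofReal (pHat h m a ^ 2) / (obsCount h m a : ℝ≥0∞)) ^ (1 / 2 : ℝ) : ℝ≥0∞))) := by
    refine Measurable.const_mul (Measurable.pow_const (Measurable.const_mul ?_ _) _) _
    exact Finset.measurable_sum _ fun m _ =>
      ((hph m).pow_const 2).ennreal_ofReal.div (hc'.comp (ho m))
  exact Measurable.add hmuA.coe_real_ereal hw.coe_ereal_ennreal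

/-- The algorithm exists: there is a policy that runs it. -/
theorem exists_isMARAlgorithm (hn : 1 ≤ n) (α : ℝ) (T : ℕ) :
    ∃ π : Policy n M, IsMARAlgorithm α T π := by
  classical
  let good (t : ℕ) (h : Hist n M t) (a : Fin n) : Prop :=
    if t < n * initPulls T then (a : ℕ) = t / initPulls T
    else ∀ b, ucb α T h b ≤ ucb α T h a
  have hex (t : ℕ) (h : Hist n M t) : ∃ a, good t h a := by
    by_cases ht : t < n * initPulls T
    · refine ⟨⟨t / initPulls T, Nat.div_lt_of_lt_mul (by rwa [mul_comm])⟩, ?_⟩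
      simp [good, ht]
    · have : Nonempty (Fin n) := ⟨⟨0, hn⟩⟩
      obtain ⟨a, ha⟩ := Finite.exists_max (fun a => ucb α T h a)
      exact ⟨a, by simpa [good, ht] using ha⟩
  have hgm (t : ℕ) (a : Fin n) : MeasurableSet {h : Hist n M t | good t h a} := by
    by_cases ht : t < n * initPulls T
    · simp [good, ht]
    · simp only [good, ht, if_false, Set.ofPred_forall]
      exact MeasurableSet.iInter fun b => measurableSet_le (measurable_ucb α T b)
        (measurable_ucb α T a)
  let f (t : ℕ) (h : Hist n M t) : Fin n := Fin.find (good t h) (hex t h)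
  have hf (t : ℕ) : Measurable (f t) := by
    refine measurable_to_countable' fun a => ?_
    have : f t ⁻¹' {a} = {h | good t h a} ∩ ⋂ b, ⋂ (_ : b < a), {h | good t h b}ᶜ := by
      ext h
      simp [f, Fin.find_eq_iff]
    rw [this]
    exact (hgm t a).inter (MeasurableSet.iInter fun b => MeasurableSet.iInter fun _ =>
      (hgm t b).compl)
  refine ⟨⟨fun t => Kernel.deterministic (f t) (hf t), fun t => inferInstance⟩, ?_⟩
  intro t _ h
  have : good t h (f t h) := Fin.find_spec (hex t h)
  rw [Kernel.deterministic_apply]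
  exact (ae_dirac_iff (MeasurableSet.of_discrete)).2 this

end Existence

end Algorithm

/-- An instance without mediator (the mediator is degenerate) in which, on each arm `a`, the
outcome is missing independently of its value and is observed with probability `γ a`; the outcomes
are `1`-sub-Gaussian, with means in `[0, 1]`. -/
structure IsMARNoMediator {n : ℕ} (ν : Instance n Unit) (γ : Fin n → ℝ) : Prop where
  indep : ∀ a, IndepFun (fun z : ℝ × Bool × Unit => z.2.1) (fun z => z.1) (ν.law a)
  obs_prob : ∀ a, (ν.law a).real {z | z.2.1 = true} = γ a
  subgaussian : ∀ a, HasSubgaussianMGF (fun z => z.1 - ν.mean a) 1 (ν.law a)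
  mean_mem : ∀ a, ν.mean a ∈ Set.Icc (0 : ℝ) 1

end MissingBandit

end

/-!
Both bounds rest on one feature of the model: along the interaction, the law of what is seen in a
round depends on the past through the pulled arm only. Expectations over histories are therefore
computed by peeling off one round at a time (`lintegral_histLaw_succ`), for an arbitrary adaptive
and randomized policy.

**Upper bound.** If an increment `φ` has exponential moment at most `1` on every arm, then
`exp (∑ φ)` is a supermartingale, which gives a Chernoff bound at each fixed time
(`histLaw_sum_ge_le`). It is applied to the observed outcomes of an arm, compensated by the
sub-Gaussian bound, and to the number of its observations. A union bound over rounds, arms and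
possible numbers of observations replaces any maximal inequality: the width of the index makes each
deviation event have probability at most `T⁻⁴` (`histLaw_not_goodAt_le`). On the good event an arm
`a` pulled `k` times has at least `γ a * k / 2` observations, so its gap when pulled is at most of
order `√(α log T / (γ a * k))` (`gap_le_of_ucb_le`); summing over rounds with the potential
`∑ a, √(pulls a / γ a)` (`sum_cost_le_potential`) and applying Cauchy–Schwarz gives
`√(α T log T ∑ 1 / γ a)` (`regret_le_of_good`). For large `T` the initial phase, of length of order
`n (log T)²`, is smaller.

**Lower bound.** Outcomes are `±1`. In the reference environment one arm has mean `Δ` and the others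
have mean `0`; in the alternative, one further arm `j` has mean `2 Δ`. An arm `j` exists whose
expected number of observations is at most `4 T (∑ γ) / n²` (`exists_arm_few_observations`), so with
`Δ` of order `n / √(T ∑ γ)` the divergence between the laws of the two histories is at most `1 / 4`.
The Donsker–Varadhan inequality for a single event (`real_histLaw_le_of_changeOfMeasure`) then
prevents the policy from pulling the first arm at least half of the time in the reference
environment and rarely in the alternative, so that it suffers regret of order `Δ T` in one of them.
-/

open MeasureTheory ProbabilityTheory
open scoped ENNReal

namespace MissingBandit

/-! ### Integrating against the law of the history -/

theorem sum_extend {n : ℕ} {M : Type} {t : ℕ} (φ : Fin n × Obs M → ℝ) (h : Hist n M t)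
    (p : Fin n × Obs M) : ∑ s, φ (extend (h, p) s) = ∑ s, φ (h s) + φ p := by
  simp [Fin.sum_univ_castSucc, extend]

section Tools

variable {n : ℕ} {M : Type} [MeasurableSpace M] {t : ℕ}

theorem lintegral_histLaw_succ (π : Policy n M) (ν : Instance n M)
    {f : Hist n M (t + 1) → ℝ≥0∞} (hf : Measurable f) :
    ∫⁻ h, f h ∂(histLaw π ν (t + 1)) =
      ∫⁻ h, ∫⁻ a, ∫⁻ o, f (extend (h, (a, o))) ∂(ν.obsKernel a) ∂(π.kernel t h)
        ∂(histLaw π ν t) := by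
  have hfe : Measurable fun p => f (extend (n := n) (M := M) (t := t) p) :=
    hf.comp measurable_extend
  rw [histLaw, lintegral_map hf measurable_extend, Measure.lintegral_compProd hfe]
  refine lintegral_congr fun h => ?_
  exact Kernel.lintegral_compProd _ _ h (hfe.comp measurable_prodMk_left)

theorem measurable_sum_hist {φ : Fin n × Obs M → ℝ} (hφ : Measurable φ) :
    Measurable fun h : Hist n M t => ∑ s, φ (h s) :=
  Finset.measurable_sum _ fun s _ => hφ.comp (measurable_pi_apply s)

/-- If, on every arm, the increment `φ` has exponential moment at most `1`, then `exp (∑ φ)` is a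
supermartingale along the interaction. -/
theorem lintegral_exp_sum_le_one (π : Policy n M) (ν : Instance n M)
    {φ : Fin n × Obs M → ℝ} (hφ : Measurable φ)
    (h1 : ∀ a, ∫⁻ o, ENNReal.ofReal (Real.exp (φ (a, o))) ∂(ν.obsKernel a) ≤ 1) :
    ∫⁻ h, ENNReal.ofReal (Real.exp (∑ s, φ (h s))) ∂(histLaw π ν t) ≤ 1 := by
  induction t with
  | zero => simp
  | succ t ih =>
    rw [lintegral_histLaw_succ π ν (measurable_sum_hist hφ).exp.ennreal_ofReal]
    refine le_trans (lintegral_mono fun h => ?_) ih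
    calc _ ≤ ∫⁻ a, ENNReal.ofReal (Real.exp (∑ s, φ (h s))) ∂(π.kernel t h) := by
          refine lintegral_mono fun a => ?_
          simp only [sum_extend, Real.exp_add, ENNReal.ofReal_mul (Real.exp_nonneg _)]
          rw [lintegral_const_mul']
          · exact mul_le_of_le_one_right' (h1 a)
          · exact ENNReal.ofReal_ne_top
      _ = _ := by simp

/-- Chernoff's bound for adaptively collected observations. It holds at a fixed time; no
independence between the rounds is involved. -/
theorem histLaw_sum_ge_le (π : Policy n M) (ν : Instance n M)
    {φ : Fin n × Obs M → ℝ} (hφ : Measurable φ)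
    (h1 : ∀ a, ∫⁻ o, ENNReal.ofReal (Real.exp (φ (a, o))) ∂(ν.obsKernel a) ≤ 1) (x : ℝ) :
    histLaw π ν t {h | x ≤ ∑ s, φ (h s)} ≤ ENNReal.ofReal (Real.exp (-x)) := by
  have hmarkov := mul_meas_ge_le_lintegral (μ := histLaw π ν t)
    (measurable_sum_hist (t := t) hφ).exp.ennreal_ofReal (ENNReal.ofReal (Real.exp x))
  have hset : {h : Hist n M t | ENNReal.ofReal (Real.exp x) ≤
      ENNReal.ofReal (Real.exp (∑ s, φ (h s)))} = {h | x ≤ ∑ s, φ (h s)} := by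
    ext h
    simp [ENNReal.ofReal_le_ofReal_iff (Real.exp_nonneg _)]
  rw [hset] at hmarkov
  have h2 := hmarkov.trans (lintegral_exp_sum_le_one π ν hφ h1)
  rw [Real.exp_neg, ENNReal.ofReal_inv_of_pos (Real.exp_pos x)]
  rw [mul_comm] at h2
  rwa [ENNReal.le_inv_iff_mul_le]

/-- The first `t` rounds of a history. -/
def truncate {T : ℕ} (t : ℕ) (ht : t ≤ T) (h : Hist n M T) : Hist n M t :=
  fun s => h (Fin.castLE ht s)

theorem measurable_truncate {T : ℕ} (ht : t ≤ T) :
    Measurable (truncate (n := n) (M := M) t ht) :=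
  measurable_pi_lambda _ fun _ => measurable_pi_apply _

theorem map_truncate_histLaw (π : Policy n M) (ν : Instance n M) {T : ℕ} (ht : t ≤ T) :
    (histLaw π ν T).map (truncate t ht) = histLaw π ν t := by
  induction T, ht using Nat.le_induction with
  | base => exact Measure.map_id
  | succ T ht ih =>
    have hcomp : truncate (n := n) (M := M) t (ht.trans T.le_succ) ∘ extend =
        truncate t ht ∘ Prod.fst := by
      funext p s
      exact Fin.snoc_castSucc (α := fun _ => Fin n × Obs M) p.2 p.1 (Fin.castLE ht s)
    rw [histLaw, Measure.map_map (measurable_truncate _) measurable_extend, hcomp,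
      ← Measure.map_map (measurable_truncate _) measurable_fst]
    change Measure.map _ (Measure.fst _) = _
    rw [Measure.fst_compProd, ih]

/-- An event with small probability after `t` rounds has small probability within any longer
history. -/
theorem histLaw_truncate_le (π : Policy n M) (ν : Instance n M) {T : ℕ} (ht : t ≤ T)
    (A : Set (Hist n M t)) :
    histLaw π ν T {h | truncate t ht h ∈ A} ≤ histLaw π ν t A := by
  rw [← map_truncate_histLaw π ν ht]
  exact Measure.le_map_apply (measurable_truncate ht).aemeasurable A

theorem ae_histLaw_truncate (π : Policy n M) (ν : Instance n M) {T : ℕ} (ht : t ≤ T)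
    {P : Hist n M t → Prop} (hP : ∀ᵐ h ∂(histLaw π ν t), P h) :
    ∀ᵐ h ∂(histLaw π ν T), P (truncate t ht h) := by
  rw [← map_truncate_histLaw π ν ht] at hP
  exact ae_of_ae_map (measurable_truncate ht).aemeasurable hP

end Tools

/-! ### Concentration of the observed averages and of the observation counts -/

section Concentration

variable {n : ℕ} {t : ℕ}

/-- Outcomes missing at random: what is seen on arm `a` is the outcome with probability `γ a`, and
the symbol for a missing outcome otherwise. -/
theorem IsMARNoMediator.lintegral_obsKernel {ν : Instance n Unit} {γ : Fin n → ℝ}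
    (hν : IsMARNoMediator ν γ) (a : Fin n) {g : Obs Unit → ℝ≥0∞} (hg : Measurable g) :
    ∫⁻ o, g o ∂(ν.obsKernel a) =
      ENNReal.ofReal (γ a) * ∫⁻ z, g ((), Sum.inl z.1) ∂(ν.law a) +
        ENNReal.ofReal (1 - γ a) * g ((), Sum.inr ()) := by
  have := ν.isProb a
  have hO : MeasurableSet {z : ℝ × Bool × Unit | z.2.1 = true} :=
    measurable_snd.fst (measurableSet_singleton true)
  have hprob : ν.law a {z | z.2.1 = true} = ENNReal.ofReal (γ a) := by
    rw [← hν.obs_prob a, ofReal_measureReal]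
  have hprob' : ν.law a {z | z.2.1 = true}ᶜ = ENNReal.ofReal (1 - γ a) := by
    rw [← hν.obs_prob a, ← ofReal_measureReal, probReal_compl_eq_one_sub hO]
  have hF : Measurable fun y : ℝ => g ((), Sum.inl y) :=
    hg.comp (measurable_const.prodMk measurable_inl)
  let u : Bool → ℝ≥0∞ := fun b => if b = true then 1 else 0
  have hind := lintegral_mul_eq_lintegral_mul_lintegral_of_indepFun''
    (μ := ν.law a) (f := fun z => u z.2.1) (g := fun z => g ((), Sum.inl z.1))
    ((measurable_of_countable u).comp measurable_snd.fst).aemeasurable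
    (hF.comp measurable_fst).aemeasurable
    ((hν.indep a).comp (measurable_of_countable u) hF)
  have hu : (fun z : ℝ × Bool × Unit => u z.2.1) =
      Set.indicator {z : ℝ × Bool × Unit | z.2.1 = true} 1 := by
    funext z
    by_cases hz : z.2.1 = true <;> simp [u, hz]
  have hsplit : (fun z : ℝ × Bool × Unit => g (observe z)) = fun z =>
      u z.2.1 * g ((), Sum.inl z.1) +
        Set.indicator {z : ℝ × Bool × Unit | z.2.1 = true}ᶜ (fun _ => g ((), Sum.inr ())) z := by
    funext z
    by_cases hz : z.2.1 = true <;> simp [u, hz, observe]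
  change ∫⁻ o, g o ∂((ν.law a).map observe) = _
  rw [lintegral_map hg measurable_observe, hsplit, lintegral_add_left]
  · rw [hind, hu, lintegral_indicator_one hO, hprob, lintegral_indicator_const hO.compl, hprob',
      mul_comm (g _)]
  · exact ((measurable_of_countable u).comp measurable_snd.fst).mul (hF.comp measurable_fst)

/-- The sum of the outcomes observed on arm `a`. -/
def obsSum (h : Hist n Unit t) (a : Fin n) : ℝ :=
  ∑ s, if (h s).1 = a then Sum.elim id (fun _ => 0) (h s).2.2 else 0

/-- The centred, exponentially compensated outcome of one round if it is observed on arm `a`. -/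
noncomputable def outcomeIncr (a : Fin n) (μ l : ℝ) (p : Fin n × Obs Unit) : ℝ :=
  if p.1 = a then Sum.elim (fun y => l * (y - μ) - l ^ 2 / 2) (fun _ => 0) p.2.2 else 0

/-- Minus the indicator of an observation on arm `a`, exponentially compensated when `g` is the
observation probability; the factor `3 / 5` is admissible since `1 - exp (-1) ≥ 3 / 5`. -/
noncomputable def countIncr (a : Fin n) (g : ℝ) (p : Fin n × Obs Unit) : ℝ :=
  if p.1 = a then Sum.elim (fun _ => 3 / 5 * g - 1) (fun _ => 3 / 5 * g) p.2.2 else 0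

theorem measurable_outcomeIncr (a : Fin n) (μ l : ℝ) : Measurable (outcomeIncr a μ l) := by
  refine Measurable.ite (measurable_fst (measurableSet_singleton a)) ?_ measurable_const
  exact (Measurable.sumElim (by fun_prop) measurable_const).comp measurable_snd.snd

theorem measurable_countIncr (a : Fin n) (g : ℝ) : Measurable (countIncr a g) := by
  refine Measurable.ite (measurable_fst (measurableSet_singleton a)) ?_ measurable_const
  exact (Measurable.sumElim measurable_const measurable_const).comp measurable_snd.snd

theorem sum_outcomeIncr (h : Hist n Unit t) (a : Fin n) (μ l : ℝ) :
    ∑ s, outcomeIncr a μ l (h s) =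
      l * (obsSum h a - obsCount h () a * μ) - obsCount h () a * (l ^ 2 / 2) := by
  rw [obsSum, obsCount]
  push_cast
  rw [Finset.sum_mul, Finset.sum_mul, ← Finset.sum_sub_distrib, Finset.mul_sum,
    ← Finset.sum_sub_distrib]
  refine Finset.sum_congr rfl fun s _ => ?_
  unfold outcomeIncr
  by_cases ha : (h s).1 = a
  · rcases hs : (h s).2.2 with y | y <;> simp [ha]
  · simp [ha]

theorem sum_countIncr (h : Hist n Unit t) (a : Fin n) (g : ℝ) :
    ∑ s, countIncr a g (h s) = 3 / 5 * g * pulls h a - obsCount h () a := by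
  rw [pulls, obsCount]
  push_cast
  rw [Finset.mul_sum, ← Finset.sum_sub_distrib]
  refine Finset.sum_congr rfl fun s _ => ?_
  unfold countIncr
  by_cases ha : (h s).1 = a
  · rcases hs : (h s).2.2 with y | y <;> simp [ha]
  · simp [ha]

theorem lintegral_exp_outcomeIncr_le {ν : Instance n Unit} {γ : Fin n → ℝ}
    (hγ : ∀ a, 0 < γ a ∧ γ a ≤ 1) (hν : IsMARNoMediator ν γ) (a : Fin n) (l : ℝ) (b : Fin n) :
    ∫⁻ o, ENNReal.ofReal (Real.exp (outcomeIncr a (ν.mean a) l (b, o))) ∂(ν.obsKernel b) ≤ 1 := by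
  have := ν.isProb a
  by_cases hb : b = a
  swap
  · simp [outcomeIncr, hb]
  subst hb
  have hm : Measurable fun o => ENNReal.ofReal (Real.exp (outcomeIncr b (ν.mean b) l (b, o))) :=
    ((measurable_outcomeIncr b _ l).comp measurable_prodMk_left).exp.ennreal_ofReal
  rw [hν.lintegral_obsKernel b hm]
  have hmgf : ∫⁻ z, ENNReal.ofReal (Real.exp (l * (z.1 - ν.mean b) - l ^ 2 / 2)) ∂(ν.law b)
      ≤ 1 := by
    simp_rw [Real.exp_sub, div_eq_mul_inv, ENNReal.ofReal_mul (Real.exp_nonneg _)]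
    rw [lintegral_mul_const' _ _ ENNReal.ofReal_ne_top,
      ← ofReal_integral_eq_lintegral_ofReal ((hν.subgaussian b).integrable_exp_mul l)
        (ae_of_all _ fun _ => Real.exp_nonneg _),
      ← ENNReal.ofReal_mul (integral_nonneg fun _ => Real.exp_nonneg _), ← Real.exp_neg]
    refine ENNReal.ofReal_le_one.2 ?_
    have h := (hν.subgaussian b).mgf_le l
    rw [mgf] at h
    calc _ ≤ Real.exp ((1 : NNReal) * l ^ 2 / 2) * Real.exp (-(l ^ 2 / 2)) :=
          mul_le_mul_of_nonneg_right h (Real.exp_nonneg _)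
      _ = 1 := by rw [← Real.exp_add]; simp
  simp only [outcomeIncr, if_true, Sum.elim_inl, Sum.elim_inr, Real.exp_zero, ENNReal.ofReal_one,
    mul_one]
  calc _ ≤ ENNReal.ofReal (γ b) * 1 + ENNReal.ofReal (1 - γ b) := by gcongr
    _ = 1 := by
      rw [mul_one, ← ENNReal.ofReal_add (hγ b).1.le (by linarith [(hγ b).2])]; simp

theorem lintegral_exp_countIncr_le {ν : Instance n Unit} {γ : Fin n → ℝ}
    (hγ : ∀ a, 0 < γ a ∧ γ a ≤ 1) (hν : IsMARNoMediator ν γ) (a b : Fin n) :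
    ∫⁻ o, ENNReal.ofReal (Real.exp (countIncr a (γ a) (b, o))) ∂(ν.obsKernel b) ≤ 1 := by
  have := ν.isProb a
  by_cases hb : b = a
  swap
  · simp [countIncr, hb]
  subst hb
  obtain ⟨h0, h1⟩ := hγ b
  have hm : Measurable fun o => ENNReal.ofReal (Real.exp (countIncr b (γ b) (b, o))) :=
    ((measurable_countIncr b _).comp measurable_prodMk_left).exp.ennreal_ofReal
  rw [hν.lintegral_obsKernel b hm]
  simp only [countIncr, if_true, Sum.elim_inl, Sum.elim_inr, lintegral_const, measure_univ, mul_one]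
  rw [← ENNReal.ofReal_mul h0.le, ← ENNReal.ofReal_mul (by linarith),
    ← ENNReal.ofReal_add (by positivity) (mul_nonneg (by linarith) (Real.exp_nonneg _))]
  refine ENNReal.ofReal_le_one.2 ?_
  have he : Real.exp (-1) ≤ 2 / 5 := by
    rw [Real.exp_neg, inv_le_comm₀ (Real.exp_pos 1) (by norm_num)]
    linarith [Real.exp_one_gt_d9]
  have hconv : 1 - 3 / 5 * γ b ≤ Real.exp (-(3 / 5 * γ b)) := by
    linarith [Real.add_one_le_exp (-(3 / 5 * γ b))]
  calc γ b * Real.exp (3 / 5 * γ b - 1) + (1 - γ b) * Real.exp (3 / 5 * γ b)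
      = (γ b * Real.exp (-1) + (1 - γ b)) * Real.exp (3 / 5 * γ b) := by
        rw [sub_eq_add_neg, Real.exp_add]; ring
    _ ≤ Real.exp (-(3 / 5 * γ b)) * Real.exp (3 / 5 * γ b) := by
        refine mul_le_mul_of_nonneg_right (le_trans ?_ hconv) (Real.exp_nonneg _)
        nlinarith
    _ = 1 := by rw [← Real.exp_add]; simp

/-- One-sided deviation of the observed sum, at a fixed number `N` of observations; the side is the
sign of `l`. -/
theorem histLaw_obsSum_le {ν : Instance n Unit} {γ : Fin n → ℝ}
    (hγ : ∀ a, 0 < γ a ∧ γ a ≤ 1) (hν : IsMARNoMediator ν γ) (π : Policy n Unit)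
    (a : Fin n) (N : ℕ) (l : ℝ) :
    histLaw π ν t {h | obsCount h () a = N ∧ N * l ^ 2 ≤ l * (obsSum h a - N * ν.mean a)} ≤
      ENNReal.ofReal (Real.exp (-(N * l ^ 2 / 2))) := by
  refine (measure_mono ?_).trans (histLaw_sum_ge_le π ν (measurable_outcomeIncr a (ν.mean a) l)
    (lintegral_exp_outcomeIncr_le hγ hν a l) (N * l ^ 2 / 2))
  rintro h ⟨hN, hl⟩
  simp only [Set.mem_ofPred_eq, sum_outcomeIncr, hN]
  linarith

/-- With `k` pulls of arm `a`, seeing fewer than half of the expected number of outcomes is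
exponentially unlikely in `k`. -/
theorem histLaw_obsCount_le {ν : Instance n Unit} {γ : Fin n → ℝ}
    (hγ : ∀ a, 0 < γ a ∧ γ a ≤ 1) (hν : IsMARNoMediator ν γ) (π : Policy n Unit)
    (a : Fin n) (k : ℝ) :
    histLaw π ν t {h | k ≤ pulls h a ∧ obsCount h () a < γ a * pulls h a / 2} ≤
      ENNReal.ofReal (Real.exp (-(γ a * k / 10))) := by
  refine (measure_mono ?_).trans (histLaw_sum_ge_le π ν (measurable_countIncr a (γ a))
    (lintegral_exp_countIncr_le hγ hν a) (γ a * k / 10))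
  rintro h ⟨hk, ho⟩
  simp only [Set.mem_ofPred_eq, sum_countIncr]
  nlinarith [mul_le_mul_of_nonneg_left hk (hγ a).1.le]

end Concentration

/-! ### Summing widths along a sequence of arms -/

section Counting

variable {n : ℕ}

/-- The number of times the sequence `A` takes the value `a` before time `t`. -/
def countBefore (A : ℕ → Fin n) (t : ℕ) (a : Fin n) : ℕ :=
  ∑ s ∈ Finset.range t, if A s = a then 1 else 0

theorem countBefore_succ (A : ℕ → Fin n) (t : ℕ) (a : Fin n) :
    countBefore A (t + 1) a = countBefore A t a + if A t = a then 1 else 0 :=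
  Finset.sum_range_succ _ _

theorem sum_countBefore (A : ℕ → Fin n) (t : ℕ) : ∑ a, countBefore A t a = t := by
  unfold countBefore
  rw [Finset.sum_comm]
  simp

theorem le_countBefore_of_roundRobin {A : ℕ → Fin n} {k t : ℕ}
    (hA : ∀ s < n * k, (A s : ℕ) = s / k) (ht : n * k ≤ t) (a : Fin n) :
    k ≤ countBefore A t a := by
  have hle : (a : ℕ) * k + k ≤ n * k := by
    rw [← Nat.succ_mul]; exact Nat.mul_le_mul_right _ a.2
  calc k = ∑ s ∈ Finset.Ico ((a : ℕ) * k) (a * k + k), if A s = a then 1 else 0 := by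
        rw [Finset.sum_congr rfl (g := fun _ => 1)]
        · simp
        · intro s hs
          rw [Finset.mem_Ico] at hs
          have : A s = a := by
            rw [Fin.ext_iff, hA s (hs.2.trans_le hle)]
            exact Nat.div_eq_of_lt_le hs.1 (by rw [Nat.succ_mul]; exact hs.2)
          simp [this]
    _ ≤ countBefore A t a := by
        refine Finset.sum_le_sum_of_subset fun s hs => ?_
        rw [Finset.mem_Ico] at hs
        exact Finset.mem_range.2 (by omega)

theorem inv_sqrt_le_sqrt_succ_sub {k : ℕ} (hk : 1 ≤ k) :
    1 / √(k : ℝ) ≤ 3 * (√((k : ℝ) + 1) - √(k : ℝ)) := by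
  have hk' : (1 : ℝ) ≤ k := by exact_mod_cast hk
  have h0 : 0 < √(k : ℝ) := Real.sqrt_pos.2 (by linarith)
  have h1 := Real.sq_sqrt (show (0 : ℝ) ≤ k by linarith)
  have h2 := Real.sq_sqrt (show (0 : ℝ) ≤ (k : ℝ) + 1 by linarith)
  have h4 : √((k : ℝ) + 1) ≤ 2 * √(k : ℝ) := by
    refine Real.sqrt_le_iff.2 ⟨by positivity, by nlinarith⟩
  have h3 : (√((k : ℝ) + 1) - √(k : ℝ)) * (√((k : ℝ) + 1) + √(k : ℝ)) = 1 := by nlinarith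
  have h5 : 0 ≤ √((k : ℝ) + 1) - √(k : ℝ) := by
    rw [sub_nonneg]; exact Real.sqrt_le_sqrt (by linarith)
  rw [div_le_iff₀ h0]
  nlinarith

/-- The potential `∑ a, w a * √(count of a)` pays for every cost `c * w a / √(count of a)` incurred
after the first `m` rounds. -/
theorem sum_cost_le_potential (A : ℕ → Fin n) (g w : Fin n → ℝ) (c : ℝ) (m T : ℕ) (hc : 0 ≤ c)
    (hw : ∀ a, 0 ≤ w a) (hg : ∀ a, g a ≤ 1)
    (hpos : ∀ t < T, m ≤ t → 1 ≤ countBefore A t (A t))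
    (hcost : ∀ t < T, m ≤ t → g (A t) ≤ c * (w (A t) * (1 / √(countBefore A t (A t) : ℝ)))) :
    ∑ t ∈ Finset.range T, g (A t) ≤
      (min T m : ℕ) + 3 * c * ∑ a, √(countBefore A T a : ℝ) * w a := by
  induction T with
  | zero => simp [countBefore]
  | succ T ih =>
    have ih' := ih (fun t ht => hpos t (ht.trans T.lt_succ_self))
      (fun t ht => hcost t (ht.trans T.lt_succ_self))
    rw [Finset.sum_range_succ]
    have hstep : ∑ a, √(countBefore A (T + 1) a : ℝ) * w a =
        ∑ a, √(countBefore A T a : ℝ) * w a +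
          (√((countBefore A T (A T) : ℝ) + 1) - √(countBefore A T (A T) : ℝ)) * w (A T) := by
      rw [← sub_eq_iff_eq_add', ← Finset.sum_sub_distrib, Finset.sum_eq_single (A T)]
      · simp [countBefore_succ]; ring
      · intro b _ hb
        simp [countBefore_succ, hb.symm]
      · simp
    rw [hstep]
    have hinc : 0 ≤ √((countBefore A T (A T) : ℝ) + 1) - √(countBefore A T (A T) : ℝ) :=
      sub_nonneg.2 (Real.sqrt_le_sqrt (by linarith))
    by_cases hT : m ≤ T
    · have h1 := hcost T T.lt_succ_self hT
      have h2 := inv_sqrt_le_sqrt_succ_sub (hpos T T.lt_succ_self hT)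
      have h3 := mul_le_mul_of_nonneg_left (mul_le_mul_of_nonneg_left h2 (hw (A T))) hc
      rw [min_eq_right (by omega)] at ih' ⊢
      nlinarith
    · have h4 : ((min (T + 1) m : ℕ) : ℝ) = (min T m : ℕ) + 1 := by
        rw [min_eq_left (by omega), min_eq_left (by omega)]; push_cast; rfl
      have h5 : 0 ≤ 3 * c * ((√((countBefore A T (A T) : ℝ) + 1) -
          √(countBefore A T (A T) : ℝ)) * w (A T)) := by
        have := hw (A T); positivity
      rw [h4]
      have := hg (A T)
      nlinarith

end Counting

/-! ### The index of the algorithm without mediator -/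

section Index

variable {n t T : ℕ}

theorem ucb_unit {α : ℝ} (hα : 0 ≤ α * Real.log T) (h : Hist n Unit t) (a : Fin n)
    (hN : 1 ≤ obsCount h () a) :
    ucb α T h a = ((obsSum h a / obsCount h () a +
      8 * √(α * Real.log T / (2 * obsCount h () a)) : ℝ) : EReal) := by
  have hle : obsCount h () a ≤ pulls h a := by
    refine Finset.sum_le_sum fun s _ => ?_
    by_cases ha : (h s).1 = a <;> simp [ha]
    split_ifs <;> simp
  have hP : (pulls h a : ℝ) ≠ 0 := by
    have : pulls h a ≠ 0 := by omega
    exact_mod_cast this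
  have hNpos : (0 : ℝ) < obsCount h () a := by exact_mod_cast hN
  have hmed : medCount h () a = pulls h a := by simp [medCount, pulls]
  have hmuMed : muHatMed h () a = obsSum h a / obsCount h () a := by
    simp [muHatMed, obsSum]
  have hmu : muHat h a = obsSum h a / obsCount h () a := by
    have : ∑ s, (if (h s).1 = a then ∑ m, muHatMed h m a * (if (h s).2.1 = m then 1 else 0) else 0)
        = pulls h a * muHatMed h () a := by
      rw [pulls]
      push_cast
      rw [Finset.sum_mul]
      refine Finset.sum_congr rfl fun s _ => ?_
      by_cases ha : (h s).1 = a <;> simp [ha]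
    rw [muHat, this, hmuMed, mul_div_cancel_left₀ _ hP]
  have hp : pHat h () a = 1 := by rw [pHat, hmed, div_self hP]
  have hw : (8 * (ENNReal.ofReal (α * Real.log T / 2) *
      ∑ m : Unit, ENNReal.ofReal (pHat h m a ^ 2) / (obsCount h m a : ℝ≥0∞)) ^ (1 / 2 : ℝ) : ℝ≥0∞)
      = ENNReal.ofReal (8 * √(α * Real.log T / (2 * obsCount h () a))) := by
    have h8 : (8 : ℝ≥0∞) = ENNReal.ofReal 8 := by simp
    have hsum : ∑ m : Unit, ENNReal.ofReal (pHat h m a ^ 2) / (obsCount h m a : ℝ≥0∞) =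
        ENNReal.ofReal (1 / obsCount h () a) := by
      rw [Finset.univ_unique, Finset.sum_singleton]
      change ENNReal.ofReal (pHat h () a ^ 2) / (obsCount h () a : ℝ≥0∞) = _
      rw [hp, ENNReal.ofReal_div_of_pos hNpos, ENNReal.ofReal_natCast]
      simp
    rw [hsum, ← ENNReal.ofReal_mul (by positivity), ENNReal.ofReal_rpow_of_nonneg (by positivity)
      (by norm_num), h8, ← ENNReal.ofReal_mul (by norm_num), ← Real.sqrt_eq_rpow]
    congr 3
    field_simp
  rw [ucb, hmu, hw, EReal.coe_ennreal_ofReal, max_eq_left (by positivity), EReal.coe_add]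

/-- At the history `h`, the observed average of arm `a` is within its confidence width of `μ`, and
at least half of the expected number of outcomes was observed on `a` if `a` was pulled
`(log T)²` times. -/
def GoodAt (α : ℝ) (T : ℕ) (g μ : ℝ) (h : Hist n Unit t) (a : Fin n) : Prop :=
  (1 ≤ obsCount h () a → |obsSum h a - obsCount h () a * μ| ≤
    obsCount h () a * (8 * √(α * Real.log T / (2 * obsCount h () a)))) ∧
  (Real.log T ^ 2 ≤ pulls h a → g * pulls h a / 2 ≤ obsCount h () a)

/-- On the good event, an arm of maximal index has a gap of at most twice its width. -/
theorem gap_le_of_ucb_le {α : ℝ} (hα : 0 ≤ α * Real.log T) {g μ : Fin n → ℝ} (hg : ∀ a, 0 < g a)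
    {h : Hist n Unit t} {a b : Fin n} (hpos : ∀ c, 1 ≤ pulls h c)
    (hinit : ∀ c, Real.log T ^ 2 ≤ pulls h c)
    (hgood : ∀ c, GoodAt α T (g c) (μ c) h c) (hucb : ucb α T h b ≤ ucb α T h a) :
    μ b - μ a ≤ 16 * √(α * Real.log T) * (√(1 / g a) * (1 / √(pulls h a : ℝ))) := by
  have hN (c : Fin n) : 1 ≤ obsCount h () c := by
    have h1 := (hgood c).2 (hinit c)
    have h2 : (0 : ℝ) < obsCount h () c := by
      refine lt_of_lt_of_le ?_ h1
      have : (1 : ℝ) ≤ pulls h c := by exact_mod_cast hpos c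
      have := hg c
      positivity
    exact_mod_cast h2
  have hdev (c : Fin n) : |obsSum h c / obsCount h () c - μ c| ≤
      8 * √(α * Real.log T / (2 * obsCount h () c)) := by
    have h0 : (0 : ℝ) < obsCount h () c := by exact_mod_cast hN c
    have h1 := (hgood c).1 (hN c)
    have h2 : obsSum h c / obsCount h () c - μ c =
        (obsSum h c - obsCount h () c * μ c) / obsCount h () c := by field_simp
    rw [h2, abs_div, abs_of_pos h0, div_le_iff₀ h0]
    linarith
  rw [ucb_unit hα h a (hN a), ucb_unit hα h b (hN b), EReal.coe_le_coe_iff] at hucb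
  have ha := abs_le.1 (hdev a)
  have hb := abs_le.1 (hdev b)
  have hP : (1 : ℝ) ≤ pulls h a := by exact_mod_cast hpos a
  have hga := hg a
  have hwidth : √(α * Real.log T / (2 * obsCount h () a)) ≤
      √(α * Real.log T) * (√(1 / g a) * (1 / √(pulls h a : ℝ))) := by
    have : √(1 / g a) * (1 / √(pulls h a : ℝ)) = √(1 / (g a * pulls h a)) := by
      rw [← Real.sqrt_one, ← Real.sqrt_div' _ (by positivity), ← Real.sqrt_mul (by positivity)]
      congr 1
      rw [Real.sqrt_one]
      field_simp
    rw [this, ← Real.sqrt_mul hα]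
    refine Real.sqrt_le_sqrt ?_
    rw [div_eq_mul_one_div]
    refine mul_le_mul_of_nonneg_left ?_ hα
    refine one_div_le_one_div_of_le (by positivity) ?_
    linarith [(hgood a).2 (hinit a)]
  linarith

end Index

/-! ### The regret of the algorithm -/

section UpperBound

variable {n : ℕ} {T : ℕ}

/-- The rule followed by the policy in round `t` holds almost surely along the interaction. -/
theorem ae_rule {M : Type} [MeasurableSpace M] (π : Policy n M) (ν : Instance n M) {t : ℕ}
    (ht : t < T) {P : Hist n M t → Fin n → Prop} (hPm : ∀ a, MeasurableSet {h | P h a})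
    (hP : ∀ h, ∀ᵐ a ∂(π.kernel t h), P h a) :
    ∀ᵐ h ∂(histLaw π ν T), P (truncate t ht.le h) (h ⟨t, ht⟩).1 := by
  have hstep : ∀ᵐ h ∂(histLaw π ν (t + 1)), P (truncate t t.le_succ h) (h (Fin.last t)).1 := by
    have hset : MeasurableSet {p : Hist n M t × (Fin n × Obs M) | P p.1 p.2.1} := by
      have : {p : Hist n M t × (Fin n × Obs M) | P p.1 p.2.1} =
          ⋃ a, (Prod.fst ⁻¹' {h | P h a} ∩ (fun p => p.2.1) ⁻¹' {a}) := by
        ext p; simp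
      rw [this]
      exact MeasurableSet.iUnion fun a => (measurable_fst (hPm a)).inter
        (measurable_snd.fst (measurableSet_singleton a))
    have hset' : MeasurableSet
        {h : Hist n M (t + 1) | P (truncate t t.le_succ h) (h (Fin.last t)).1} :=
      ((measurable_truncate t.le_succ).prodMk (measurable_pi_apply (Fin.last t))) hset
    rw [histLaw, ae_map_iff measurable_extend.aemeasurable hset']
    have hext (p : Hist n M t × (Fin n × Obs M)) :
        (P (truncate t t.le_succ (extend p)) (extend p (Fin.last t)).1) ↔ P p.1 p.2.1 := by
      have h1 : truncate t t.le_succ (extend p) = p.1 := by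
        funext s
        exact Fin.snoc_castSucc (α := fun _ => Fin n × Obs M) p.2 p.1 s
      have h2 : extend p (Fin.last t) = p.2 :=
        Fin.snoc_last (α := fun _ => Fin n × Obs M) p.2 p.1
      rw [h1, h2]
    simp only [hext]
    refine Measure.ae_compProd_of_ae_ae hset (ae_of_all _ fun h => ?_)
    refine Kernel.ae_compProd_of_ae_ae (p := fun q : Fin n × Obs M => P h q.1)
      (measurable_fst (t := {a | P h a}) (MeasurableSet.of_discrete)) ?_
    filter_upwards [hP h] with a ha
    exact ae_of_all _ fun _ => ha
  exact ae_histLaw_truncate π ν (t := t + 1) ht hstep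

theorem integral_le_of_rare_exception {Ω : Type*} [MeasurableSpace Ω] {μ : Measure Ω}
    [IsProbabilityMeasure μ] {R : Ω → ℝ} {bad : Set Ω} {B K ε : ℝ} (hB : 0 ≤ B) (hK : 0 ≤ K)
    (hε : 0 ≤ ε) (hbad : μ bad ≤ ENNReal.ofReal ε) (h1 : ∀ᵐ x ∂μ, x ∉ bad → R x ≤ B)
    (h2 : ∀ x, R x ≤ K) : ∫ x, R x ∂μ ≤ B + K * ε := by
  by_cases hR : Integrable R μ
  swap
  · rw [integral_undef hR]; positivity
  set D := toMeasurable μ bad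
  have hD : MeasurableSet D := measurableSet_toMeasurable μ bad
  have hmeas : μ.real D ≤ ε := by
    rw [measureReal_def, measure_toMeasurable]
    exact ENNReal.toReal_le_of_le_ofReal hε hbad
  calc ∫ x, R x ∂μ ≤ ∫ x, (B + D.indicator (fun _ => K) x) ∂μ := by
        refine integral_mono_ae hR ((integrable_const B).add
          ((integrable_const K).indicator hD)) ?_
        filter_upwards [h1] with x hx
        by_cases hxD : x ∈ D
        · simp only [hxD, Set.indicator_of_mem]
          linarith [h2 x]
        · simp only [hxD, not_false_eq_true, Set.indicator_of_notMem, add_zero]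
          exact hx fun h => hxD (subset_toMeasurable μ bad h)
    _ = B + K * μ.real D := by
        rw [integral_add (integrable_const B) ((integrable_const K).indicator hD),
          integral_indicator_const K hD]
        simp [mul_comm]
    _ ≤ B + K * ε := by gcongr

theorem histLaw_not_goodAt_le {ν : Instance n Unit} {γ : Fin n → ℝ}
    (hγ : ∀ a, 0 < γ a ∧ γ a ≤ 1) (hν : IsMARNoMediator ν γ) (π : Policy n Unit) {α : ℝ}
    (hα : 1 < α) (hT : 1 ≤ Real.log T) (a : Fin n) (hγT : 40 ≤ γ a * Real.log T)
    {t : ℕ} (ht : t ≤ T) :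
    histLaw π ν t {h | ¬ GoodAt α T (γ a) (ν.mean a) h a} ≤
      ENNReal.ofReal ((2 * T + 1) * Real.exp (-(4 * Real.log T))) := by
  set L := Real.log T
  set l : ℕ → ℝ := fun N => 8 * √(α * L / (2 * N))
  have hαL : 0 ≤ α * L := by positivity
  have hl (N : ℕ) (hN : 1 ≤ N) : (N : ℝ) * l N ^ 2 / 2 = 16 * (α * L) := by
    have : (0 : ℝ) < N := by exact_mod_cast hN
    simp only [l, mul_pow]
    rw [Real.sq_sqrt (by positivity)]
    field_simp
    norm_num
  have hexp1 : Real.exp (-(16 * (α * L))) ≤ Real.exp (-(4 * L)) := by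
    refine Real.exp_le_exp.2 ?_
    nlinarith
  have hexp2 : Real.exp (-(γ a * L ^ 2 / 10)) ≤ Real.exp (-(4 * L)) := by
    refine Real.exp_le_exp.2 ?_
    nlinarith
  let dev (N : ℕ) (r : ℝ) : Set (Hist n Unit t) :=
    {h | obsCount h () a = N ∧ N * r ^ 2 ≤ r * (obsSum h a - N * ν.mean a)}
  let few : Set (Hist n Unit t) :=
    {h | L ^ 2 ≤ pulls h a ∧ obsCount h () a < γ a * pulls h a / 2}
  have hcover : {h : Hist n Unit t | ¬ GoodAt α T (γ a) (ν.mean a) h a} ⊆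
      (⋃ N ∈ Finset.Icc 1 T, (dev N (l N) ∪ dev N (-l N))) ∪ few := by
    intro h hh
    simp only [Set.mem_ofPred_eq, GoodAt, not_and_or, Classical.not_imp, not_le] at hh
    rcases hh with ⟨h1, h2⟩ | ⟨h1, h2⟩
    · left
      have hNT : obsCount h () a ≤ T := by
        refine le_trans ?_ ht
        calc obsCount h () a ≤ ∑ _s : Fin t, 1 :=
              Finset.sum_le_sum fun s _ => by split_ifs <;> simp
          _ = t := by simp
      simp only [Set.mem_iUnion]
      refine ⟨obsCount h () a, Finset.mem_Icc.2 ⟨h1, hNT⟩, ?_⟩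
      have hl0 : 0 ≤ l (obsCount h () a) := by positivity
      rcases lt_abs.1 h2 with h3 | h3
      · left
        refine ⟨rfl, ?_⟩
        have := mul_le_mul_of_nonneg_left h3.le hl0
        simp only [l] at this ⊢
        linarith
      · right
        refine ⟨rfl, ?_⟩
        have := mul_le_mul_of_nonneg_left h3.le hl0
        simp only [l] at this ⊢
        linarith
    · exact Or.inr ⟨h1, h2⟩
  have hdev (N : ℕ) (hN : N ∈ Finset.Icc 1 T) :
      histLaw π ν t (dev N (l N) ∪ dev N (-l N)) ≤ ENNReal.ofReal (2 * Real.exp (-(4 * L))) := by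
    have hN1 := (Finset.mem_Icc.1 hN).1
    have h1 := histLaw_obsSum_le (t := t) hγ hν π a N (l N)
    have h2 := histLaw_obsSum_le (t := t) hγ hν π a N (-l N)
    rw [neg_sq (l N)] at h2
    rw [hl N hN1] at h1 h2
    rw [two_mul, ENNReal.ofReal_add (Real.exp_nonneg _) (Real.exp_nonneg _)]
    refine (measure_union_le _ _).trans (add_le_add ?_ ?_)
    · exact h1.trans (ENNReal.ofReal_le_ofReal hexp1)
    · simp only [dev, neg_sq (l N)]
      exact h2.trans (ENNReal.ofReal_le_ofReal hexp1)
  calc _ ≤ histLaw π ν t (⋃ N ∈ Finset.Icc 1 T, (dev N (l N) ∪ dev N (-l N))) +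
        histLaw π ν t few := (measure_mono hcover).trans (measure_union_le _ _)
    _ ≤ ∑ _N ∈ Finset.Icc 1 T, ENNReal.ofReal (2 * Real.exp (-(4 * L))) +
        ENNReal.ofReal (Real.exp (-(4 * L))) := by
        refine add_le_add ((measure_biUnion_finset_le _ _).trans (Finset.sum_le_sum hdev)) ?_
        exact (histLaw_obsCount_le hγ hν π a (L ^ 2)).trans (ENNReal.ofReal_le_ofReal hexp2)
    _ = _ := by
        rw [← ENNReal.ofReal_sum_of_nonneg (fun _ _ => by positivity),
          ← ENNReal.ofReal_add (by positivity) (Real.exp_nonneg _)]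
        congr 1
        simp
        ring

/-- On the good event, the regret is the length of the initial phase plus a sum of widths, which
the potential and the Cauchy–Schwarz inequality bound. -/
theorem regret_le_of_good {γ : Fin n → ℝ} (hγ : ∀ a, 0 < γ a ∧ γ a ≤ 1) {α : ℝ} (hα : 1 < α)
    (hT : 1 ≤ Real.log T) {μ : Fin n → ℝ} (hμ : ∀ a, μ a ∈ Set.Icc (0 : ℝ) 1) (b : Fin n)
    (h : Hist n Unit T)
    (hrule : ∀ t (ht : t < T), if t < n * initPulls T then ((h ⟨t, ht⟩).1 : ℕ) = t / initPulls T
      else ∀ b, ucb α T (truncate t ht.le h) b ≤ ucb α T (truncate t ht.le h) (h ⟨t, ht⟩).1)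
    (hgood : ∀ t (ht : t < T) a, GoodAt α T (γ a) (μ a) (truncate t ht.le h) a) :
    ∑ t, (μ b - μ (h t).1) ≤
      n * initPulls T + 48 * (√(α * Real.log T) * (√T * √(∑ a, 1 / γ a))) := by
  set k := initPulls T
  have hαL : 0 ≤ α * Real.log T := by positivity
  -- The arms are extended to an infinite sequence that continues the initial round robin, so that
  -- the length of the initial phase need not be compared with `T`.
  let A : ℕ → Fin n := fun t =>
    if ht : t < T then (h ⟨t, ht⟩).1 else if ht' : t / k < n then ⟨t / k, ht'⟩ else b
  have hA (t : ℕ) (ht : t < T) : A t = (h ⟨t, ht⟩).1 := by simp [A, ht]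
  have hround : ∀ s < n * k, (A s : ℕ) = s / k := by
    intro s hs
    by_cases hsT : s < T
    · have := hrule s hsT
      rw [if_pos hs] at this
      rw [hA s hsT, this]
    · have : s / k < n := Nat.div_lt_of_lt_mul (by rwa [mul_comm])
      simp [A, hsT, this]
  have hcount (t : ℕ) (ht : t < T) (a : Fin n) :
      pulls (truncate t ht.le h) a = countBefore A t a := by
    rw [pulls, countBefore, ← Fin.sum_univ_eq_sum_range (fun s => if A s = a then 1 else 0)]
    refine Finset.sum_congr rfl fun s _ => ?_
    rw [hA s (s.2.trans ht)]
    rfl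
  have hk : Real.log T ^ 2 ≤ k := Nat.le_ceil _
  have hk1 : 1 ≤ k := by
    have : (1 : ℝ) ≤ k := le_trans (by nlinarith) hk
    exact_mod_cast this
  have hinit (t : ℕ) (hmt : n * k ≤ t) (a : Fin n) : k ≤ countBefore A t a :=
    le_countBefore_of_roundRobin hround hmt a
  have hmain := sum_cost_le_potential A (fun a => μ b - μ a) (fun a => √(1 / γ a))
    (16 * √(α * Real.log T)) (n * k) T (by positivity) (fun a => Real.sqrt_nonneg _)
    (fun a => by linarith [(hμ b).2, (hμ a).1])
    (fun t _ hmt => hk1.trans (hinit t hmt _))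
    (fun t ht hmt => by
      have hr := hrule t ht
      rw [if_neg (by omega)] at hr
      have := gap_le_of_ucb_le (a := (h ⟨t, ht⟩).1) (b := b) hαL (fun a => (hγ a).1)
        (fun c => by rw [hcount t ht]; exact hk1.trans (hinit t hmt c))
        (fun c => by rw [hcount t ht]; exact hk.trans (by exact_mod_cast hinit t hmt c))
        (hgood t ht) (hr b)
      rw [hcount t ht, ← hA t ht] at this
      exact this)
  have hcs : ∑ a, √(countBefore A T a : ℝ) * √(1 / γ a) ≤ √T * √(∑ a, 1 / γ a) := by
    have := Real.sum_sqrt_mul_sqrt_le (s := Finset.univ) (f := fun a => (countBefore A T a : ℝ))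
      (g := fun a => 1 / γ a) (fun a => by positivity) (fun a => by have := (hγ a).1; positivity)
    rwa [← Nat.cast_sum, sum_countBefore] at this
  have hsum : ∑ t, (μ b - μ (h t).1) = ∑ t ∈ Finset.range T, (μ b - μ (A t)) := by
    rw [← Fin.sum_univ_eq_sum_range (fun t => μ b - μ (A t))]
    refine Finset.sum_congr rfl fun t _ => ?_
    rw [hA t t.2]
  rw [hsum]
  refine hmain.trans (add_le_add ?_ ?_)
  · exact_mod_cast min_le_right _ _
  · calc _ ≤ 3 * (16 * √(α * Real.log T)) * (√T * √(∑ a, 1 / γ a)) := by gcongr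
      _ = _ := by ring

theorem expectedRegret_le {γ : Fin n → ℝ} (hn : 1 ≤ n) (hγ : ∀ a, 0 < γ a ∧ γ a ≤ 1) {α : ℝ}
    (hα : 1 < α) (hT : 1 ≤ Real.log T) (hγT : ∀ a, 40 ≤ γ a * Real.log T) (hnT : n ≤ T)
    (π : Policy n Unit) (hπ : IsMARAlgorithm α T π) (ν : Instance n Unit)
    (hν : IsMARNoMediator ν γ) :
    expectedRegret π ν T ≤
      n * initPulls T + 48 * (√(α * Real.log T) * (√T * √(∑ a, 1 / γ a))) + 3 := by
  have : Nonempty (Fin n) := ⟨⟨0, hn⟩⟩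
  obtain ⟨b, hb⟩ := exists_eq_ciSup_of_finite (f := ν.mean)
  set p : ℝ := (2 * T + 1) * Real.exp (-(4 * Real.log T))
  have hp : 0 ≤ p := by positivity
  let bad : Set (Hist n Unit T) :=
    ⋃ t : Fin T, ⋃ a, {h | truncate t t.2.le h ∈ {h | ¬ GoodAt α T (γ a) (ν.mean a) h a}}
  have hbad : histLaw π ν T bad ≤ ENNReal.ofReal (T * (n * p)) := by
    calc histLaw π ν T bad ≤ ∑ _t : Fin T, ∑ _a : Fin n, ENNReal.ofReal p := by
          refine (measure_iUnion_fintype_le _ _).trans (Finset.sum_le_sum fun t _ => ?_)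
          refine (measure_iUnion_fintype_le _ _).trans (Finset.sum_le_sum fun a _ => ?_)
          exact (histLaw_truncate_le π ν t.2.le _).trans
            (histLaw_not_goodAt_le hγ hν π hα hT a (hγT a) t.2.le)
      _ = ENNReal.ofReal (T * (n * p)) := by
          rw [ENNReal.ofReal_mul (Nat.cast_nonneg T), ENNReal.ofReal_mul (Nat.cast_nonneg n)]
          simp only [Finset.sum_const, Finset.card_univ, Fintype.card_fin, nsmul_eq_mul,
            ENNReal.ofReal_natCast]
  have hrule : ∀ᵐ h ∂(histLaw π ν T), ∀ t : Fin T,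
      if (t : ℕ) < n * initPulls T then ((h ⟨t, t.2⟩).1 : ℕ) = t / initPulls T
      else ∀ b, ucb α T (truncate t t.2.le h) b ≤
        ucb α T (truncate t t.2.le h) (h ⟨t, t.2⟩).1 := by
    rw [ae_all_iff]
    intro t
    refine ae_rule π ν t.2 (P := fun h a => if (t : ℕ) < n * initPulls T then
      (a : ℕ) = t / initPulls T else ∀ b, ucb α T h b ≤ ucb α T h a) (fun a => ?_) (hπ t t.2)
    by_cases ht : (t : ℕ) < n * initPulls T
    · simp [ht]
    · simp only [ht, if_false, Set.ofPred_forall]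
      exact MeasurableSet.iInter fun b => measurableSet_le (measurable_ucb α T b)
        (measurable_ucb α T a)
  have hTpos : (0 : ℝ) < T := by
    have : 0 < T := by omega
    exact_mod_cast this
  have hfinal : (T : ℝ) * (T * (n * p)) ≤ 3 := by
    have hexp : Real.exp (-(4 * Real.log T)) = 1 / (T : ℝ) ^ 4 := by
      rw [Real.exp_neg, show 4 * Real.log T = Real.log ((T : ℝ) ^ 4) by
        rw [Real.log_pow]; norm_num, Real.exp_log (by positivity)]
      simp
    have h1 : (n : ℝ) ≤ T := by exact_mod_cast hnT
    have h2 : (1 : ℝ) ≤ T := by exact_mod_cast hn.trans hnT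
    simp only [p, hexp]
    calc (T : ℝ) * (T * (n * ((2 * T + 1) * (1 / (T : ℝ) ^ 4))))
        ≤ (T : ℝ) * (T * (T * ((2 * T + T) * (1 / (T : ℝ) ^ 4)))) := by gcongr
      _ = 3 := by field_simp; norm_num
  refine (integral_le_of_rare_exception (B := n * initPulls T +
      48 * (√(α * Real.log T) * (√T * √(∑ a, 1 / γ a)))) (K := T) (by positivity) hTpos.le
    (by positivity) hbad ?_ fun h => ?_).trans (by linarith)
  · filter_upwards [hrule] with h hh hnot
    simp only [bad, Set.mem_iUnion, not_exists, Set.mem_ofPred_eq, not_not] at hnot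
    rw [← hb]
    exact regret_le_of_good hγ hα hT hν.mean_mem b h (fun t ht => hh ⟨t, ht⟩)
      (fun t ht a => hnot ⟨t, ht⟩ a)
  · calc _ ≤ ∑ _t : Fin T, (1 : ℝ) := by
          refine Finset.sum_le_sum fun t _ => ?_
          rw [← hb]
          linarith [(hν.mean_mem b).2, (hν.mean_mem (h t).1).1]
      _ = T := by simp

theorem exists_forall_large_horizon (n : ℕ) (γ : Fin n → ℝ) (hγ : ∀ a, 0 < γ a) :
    ∃ T₀ : ℕ, ∀ T : ℕ, T₀ ≤ T → 1 ≤ Real.log T ∧ (∀ a, 40 ≤ γ a * Real.log T) ∧ n ≤ T ∧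
      (n : ℝ) * initPulls T ≤ √T := by
  have hlog : Filter.Tendsto (fun T : ℕ => Real.log T) Filter.atTop Filter.atTop :=
    Real.tendsto_log_atTop.comp tendsto_natCast_atTop_atTop
  have h1 := hlog.eventually_ge_atTop 1
  have h2 : ∀ᶠ T : ℕ in Filter.atTop, ∀ a, 40 ≤ γ a * Real.log T := by
    rw [Filter.eventually_all]
    intro a
    filter_upwards [hlog.eventually_ge_atTop (40 / γ a)] with T hT
    rw [div_le_iff₀ (hγ a)] at hT
    linarith
  have h3 := Filter.eventually_ge_atTop (α := ℕ) n
  have h4 : ∀ᶠ T : ℕ in Filter.atTop, Real.log T ^ 4 ≤ (1 / (4 * (n : ℝ) ^ 2 + 1)) * T := by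
    have h := ((Real.isLittleO_pow_log_id_atTop (n := 4)).comp_tendsto
      tendsto_natCast_atTop_atTop).bound
      (show (0 : ℝ) < 1 / (4 * (n : ℝ) ^ 2 + 1) by positivity)
    filter_upwards [h] with T hT
    have h5 := (le_abs_self _).trans hT
    simpa using h5
  obtain ⟨T₀, hT₀⟩ := Filter.eventually_atTop.1 (h1.and (h2.and (h3.and h4)))
  refine ⟨T₀, fun T hT => ?_⟩
  obtain ⟨h1, h2, h3, h4⟩ := hT₀ T hT
  refine ⟨h1, h2, h3, ?_⟩
  have hceil : (initPulls T : ℝ) ≤ 2 * Real.log T ^ 2 := by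
    have := Nat.ceil_lt_add_one (sq_nonneg (Real.log T))
    rw [initPulls]
    nlinarith
  refine Real.le_sqrt_of_sq_le ?_
  have hD : (0 : ℝ) < 4 * (n : ℝ) ^ 2 + 1 := by positivity
  rw [one_div, ← div_eq_inv_mul, le_div_iff₀ hD] at h4
  calc ((n : ℝ) * initPulls T) ^ 2 ≤ (n * (2 * Real.log T ^ 2)) ^ 2 := by gcongr
    _ = Real.log T ^ 4 * (4 * (n : ℝ) ^ 2) := by ring
    _ ≤ Real.log T ^ 4 * (4 * (n : ℝ) ^ 2 + 1) := by gcongr; linarith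
    _ ≤ T := h4

theorem exists_regret_upper_bound :
    ∃ C : ℝ, 0 < C ∧ ∀ (n : ℕ), 1 ≤ n → ∀ γ : Fin n → ℝ, (∀ a, 0 < γ a ∧ γ a ≤ 1) →
      ∀ α : ℝ, 1 < α → ∀ S : ℝ, S = (∑ a, 1 / γ a) / n →
      ∃ T₀ : ℕ, ∀ T : ℕ, T₀ ≤ T → ∀ π : Policy n Unit, IsMARAlgorithm α T π →
      ∀ ν : Instance n Unit, IsMARNoMediator ν γ →
        expectedRegret π ν T ≤ C * Real.sqrt (α * T * Real.log T * n * S) := by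
  refine ⟨52, by norm_num, fun n hn γ hγ α hα S hS => ?_⟩
  obtain ⟨T₀, hT₀⟩ := exists_forall_large_horizon n γ fun a => (hγ a).1
  refine ⟨T₀, fun T hT π hπ ν hν => ?_⟩
  obtain ⟨hL, hγT, hnT, hphase⟩ := hT₀ T hT
  have hreg := expectedRegret_le hn hγ hα hL hγT hnT π hπ ν hν
  have hn0 : (n : ℝ) ≠ 0 := by
    have : n ≠ 0 := by omega
    exact_mod_cast this
  have hT1 : (1 : ℝ) ≤ T := by exact_mod_cast hn.trans hnT
  have hQ : 1 ≤ ∑ a, 1 / γ a := by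
    calc (1 : ℝ) ≤ n := by exact_mod_cast hn
      _ = ∑ _a : Fin n, (1 : ℝ) := by simp
      _ ≤ ∑ a, 1 / γ a := Finset.sum_le_sum fun a _ => by
          rw [le_div_iff₀ (hγ a).1]; linarith [(hγ a).2]
  have hX : √(α * T * Real.log T * n * S) =
      √(α * Real.log T) * (√T * √(∑ a, 1 / γ a)) := by
    rw [← Real.sqrt_mul (by positivity), ← Real.sqrt_mul (by positivity), hS]
    congr 1
    field_simp
  have h1 : 1 ≤ √(α * Real.log T) := Real.one_le_sqrt.2 (by nlinarith)
  have h2 : 1 ≤ √(∑ a, 1 / γ a) := Real.one_le_sqrt.2 hQ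
  have h3 : 1 ≤ √(T : ℝ) := Real.one_le_sqrt.2 hT1
  have h4 : √(T : ℝ) ≤ √(T : ℝ) * √(∑ a, 1 / γ a) := le_mul_of_one_le_right (by positivity) h2
  have h5 : √(T : ℝ) * √(∑ a, 1 / γ a) ≤ √(α * Real.log T) * (√(T : ℝ) * √(∑ a, 1 / γ a)) :=
    le_mul_of_one_le_left (by positivity) h1
  rw [hX]
  linarith

end UpperBound

/-! ### Change of measure between two environments -/

section ChangeOfMeasure

variable {n : ℕ} {M : Type} [MeasurableSpace M] {t : ℕ}

/-- If `exp ψ` is the likelihood ratio of one round, then `exp (∑ ψ)` is the likelihood ratio of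
the whole history, whatever the policy. -/
theorem lintegral_histLaw_changeOfMeasure (π : Policy n M) {ν ν' : Instance n M}
    {ψ : Fin n × Obs M → ℝ} (hψ : Measurable ψ)
    (hratio : ∀ a, ∀ g : Obs M → ℝ≥0∞, Measurable g → ∫⁻ o, g o ∂(ν'.obsKernel a) =
      ∫⁻ o, g o * ENNReal.ofReal (Real.exp (ψ (a, o))) ∂(ν.obsKernel a))
    {f : Hist n M t → ℝ≥0∞} (hf : Measurable f) :
    ∫⁻ h, f h ∂(histLaw π ν' t) =
      ∫⁻ h, f h * ENNReal.ofReal (Real.exp (∑ s, ψ (h s))) ∂(histLaw π ν t) := by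
  induction t with
  | zero => simp [histLaw]
  | succ t ih =>
    have hfe : Measurable fun p => f (extend (n := n) (M := M) (t := t) p) :=
      hf.comp measurable_extend
    have hg : Measurable fun q : (Hist n M t × Fin n) × Obs M =>
        f (extend (q.1.1, (q.1.2, q.2))) * ENNReal.ofReal (Real.exp (ψ (q.1.2, q.2))) := by
      refine (hfe.comp (by fun_prop)).mul ?_
      exact (hψ.comp (by fun_prop)).exp.ennreal_ofReal
    have hin : Measurable fun h : Hist n M t => ∫⁻ a, ∫⁻ o, f (extend (h, (a, o))) *
        ENNReal.ofReal (Real.exp (ψ (a, o))) ∂(ν.obsKernel a) ∂(π.kernel t h) := by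
      have h1 : Measurable fun q : Hist n M t × Fin n => ∫⁻ o, f (extend (q.1, (q.2, o))) *
          ENNReal.ofReal (Real.exp (ψ (q.2, o))) ∂(ν.obsKernel q.2) := by
        exact Measurable.lintegral_kernel_prod_right'
          (κ := Kernel.prodMkLeft (Hist n M t) ν.obsKernel) hg
      exact Measurable.lintegral_kernel_prod_right' h1
    have hfψ : Measurable fun h : Hist n M (t + 1) =>
        f h * ENNReal.ofReal (Real.exp (∑ s, ψ (h s))) :=
      hf.mul (measurable_sum_hist hψ).exp.ennreal_ofReal
    rw [lintegral_histLaw_succ π ν' hf, lintegral_histLaw_succ π ν hfψ]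
    have h2 (h : Hist n M t) (a : Fin n) : ∫⁻ o, f (extend (h, (a, o))) ∂(ν'.obsKernel a) =
        ∫⁻ o, f (extend (h, (a, o))) * ENNReal.ofReal (Real.exp (ψ (a, o))) ∂(ν.obsKernel a) :=
      hratio a _ (hfe.comp (by fun_prop))
    simp only [h2]
    rw [ih hin]
    refine lintegral_congr fun h => ?_
    rw [← lintegral_mul_const' _ _ ENNReal.ofReal_ne_top]
    refine lintegral_congr fun a => ?_
    rw [← lintegral_mul_const' _ _ ENNReal.ofReal_ne_top]
    refine lintegral_congr fun o => ?_
    rw [sum_extend, Real.exp_add, ENNReal.ofReal_mul (Real.exp_nonneg _)]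
    ring

/-- The mean of a sum of bounded functions of the rounds, computed by conditioning on the arms. -/
theorem integral_sum_hist (π : Policy n M) (ν : Instance n M) {ψ : Fin n × Obs M → ℝ}
    (hψ : Measurable ψ) {K : ℝ} (hK : ∀ p, |ψ p| ≤ K) :
    ∫ h, ∑ s, ψ (h s) ∂(histLaw π ν t) =
      ∫ h, ∑ s, (∫ o, ψ ((h s).1, o) ∂(ν.obsKernel (h s).1)) ∂(histLaw π ν t) := by
  set m : Fin n → ℝ := fun a => ∫ o, ψ (a, o) ∂(ν.obsKernel a)
  set φ : Fin n × Obs M → ℝ := fun p => ψ p - m p.1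
  have hm : Measurable fun p : Fin n × Obs M => m p.1 :=
    (measurable_of_countable m).comp measurable_fst
  have hmK (a : Fin n) : |m a| ≤ K := by
    have := norm_integral_le_of_norm_le_const (μ := ν.obsKernel a) (f := fun o => ψ (a, o))
      (ae_of_all _ fun o => hK (a, o))
    simpa using this
  have hφ : Measurable φ := hψ.sub hm
  have hbound {χ : Fin n × Obs M → ℝ} {B : ℝ} (hB : ∀ p, |χ p| ≤ B) {r : ℕ} (h : Hist n M r) :
      ‖∑ s, χ (h s)‖ ≤ r * B := by
    refine (norm_sum_le _ _).trans ((Finset.sum_le_sum fun s _ => hB (h s)).trans ?_)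
    simp
  have hint {χ : Fin n × Obs M → ℝ} {B : ℝ} (hχ : Measurable χ) (hB : ∀ p, |χ p| ≤ B) (r : ℕ) :
      Integrable (fun h : Hist n M r => ∑ s, χ (h s)) (histLaw π ν r) :=
    Integrable.of_bound (measurable_sum_hist hχ).aestronglyMeasurable _
      (ae_of_all _ fun h => hbound hB h)
  have hφK (p : Fin n × Obs M) : |φ p| ≤ K + K :=
    (abs_sub _ _).trans (add_le_add (hK p) (hmK p.1))
  have hφint (a : Fin n) : ∫ o, φ (a, o) ∂(ν.obsKernel a) = 0 := by
    have : Integrable (fun o => ψ (a, o)) (ν.obsKernel a) :=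
      Integrable.of_bound (hψ.comp measurable_prodMk_left).aestronglyMeasurable K
        (ae_of_all _ fun o => hK (a, o))
    simp only [φ]
    rw [integral_sub this (integrable_const _)]
    simp [m]
  have hzero : ∫ h, ∑ s, φ (h s) ∂(histLaw π ν t) = 0 := by
    induction t with
    | zero => simp
    | succ t ih =>
      have hI : Integrable (fun p : Hist n M t × (Fin n × Obs M) => ∑ s, φ (extend p s))
          (histLaw π ν t ⊗ₘ stepKernel π ν t) :=
        Integrable.of_bound ((measurable_sum_hist hφ).comp measurable_extend).aestronglyMeasurable
          _ (ae_of_all _ fun p => hbound hφK (extend p))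
      rw [histLaw, integral_map measurable_extend.aemeasurable
        (measurable_sum_hist hφ).aestronglyMeasurable, Measure.integral_compProd hI, ← ih]
      refine integral_congr_ae (ae_of_all _ fun h => ?_)
      have hIφ : Integrable φ (stepKernel π ν t h) :=
        Integrable.of_bound hφ.aestronglyMeasurable _ (ae_of_all _ hφK)
      simp only [sum_extend]
      rw [integral_add (integrable_const _) hIφ]
      have : ∫ p, φ p ∂(stepKernel π ν t h) = 0 := by
        rw [stepKernel] at hIφ ⊢
        rw [ProbabilityTheory.integral_compProd hIφ]
        simp [Kernel.prodMkLeft_apply, hφint]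
      simp [this]
  have hsub := integral_sub (hint hψ hK t) (hint hm (fun p => hmK p.1) t)
  simp only [← Finset.sum_sub_distrib] at hsub
  have hzero' : ∫ h, ∑ s, (ψ (h s) - m (h s).1) ∂(histLaw π ν t) = 0 := hzero
  linarith

/-- The Donsker–Varadhan inequality for the indicator of an event `B`: if the divergence between
the two laws of the history is small, an event that is likely under `ν` is not rare under `ν'`.
The divergence enters as the expectation of minus the log-likelihood ratio. -/
theorem real_histLaw_le_of_changeOfMeasure (π : Policy n M) {ν ν' : Instance n M}
    {ψ : Fin n × Obs M → ℝ} (hψ : Measurable ψ) {K : ℝ} (hK : ∀ p, |ψ p| ≤ K)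
    (hratio : ∀ a, ∀ g : Obs M → ℝ≥0∞, Measurable g → ∫⁻ o, g o ∂(ν'.obsKernel a) =
      ∫⁻ o, g o * ENNReal.ofReal (Real.exp (ψ (a, o))) ∂(ν.obsKernel a))
    {B : Set (Hist n M t)} (hB : MeasurableSet B) :
    (histLaw π ν t).real B + ∫ h, ∑ s, ψ (h s) ∂(histLaw π ν t) ≤
      (histLaw π ν' t).real B * (Real.exp 1 - 1) := by
  set P := histLaw π ν t
  set l : Hist n M t → ℝ := fun h => ∑ s, ψ (h s)
  have hl : Measurable l := measurable_sum_hist hψ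
  have hbound (h : Hist n M t) : |l h| ≤ t * K := by
    refine (Finset.abs_sum_le_sum_abs _ _).trans ((Finset.sum_le_sum fun s _ => hK (h s)).trans ?_)
    simp
  have hlI : Integrable l P :=
    Integrable.of_bound hl.aestronglyMeasurable _ (ae_of_all _ hbound)
  have heI : Integrable (fun h => Real.exp (l h)) P := by
    refine Integrable.of_bound hl.exp.aestronglyMeasurable (Real.exp (t * K)) (ae_of_all _ ?_)
    intro h
    rw [Real.norm_eq_abs, abs_of_pos (Real.exp_pos _)]
    exact Real.exp_le_exp.2 ((le_abs_self _).trans (hbound h))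
  have hmass {D : Set (Hist n M t)} (hD : MeasurableSet D) :
      ∫ h, D.indicator (fun h => Real.exp (l h)) h ∂P = (histLaw π ν' t).real D := by
    rw [integral_eq_lintegral_of_nonneg_ae
      (ae_of_all _ fun h => Set.indicator_nonneg (fun _ _ => Real.exp_nonneg _) h)
      (hl.exp.indicator hD).aestronglyMeasurable, measureReal_def, ← lintegral_indicator_one hD,
      lintegral_histLaw_changeOfMeasure π hψ hratio (measurable_one.indicator hD)]
    congr 1
    refine lintegral_congr fun h => ?_
    by_cases hh : h ∈ D <;> simp [hh, l]
  have htotal : ∫ h, Real.exp (l h) ∂P = 1 := by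
    have := hmass MeasurableSet.univ
    simpa using this
  have hpt (h : Hist n M t) : B.indicator (fun _ => (1 : ℝ)) h + l h ≤
      B.indicator (fun h => Real.exp (l h)) h * (Real.exp 1 - 1) + (Real.exp (l h) - 1) := by
    by_cases hh : h ∈ B
    · simp only [hh, Set.indicator_of_mem]
      have := Real.add_one_le_exp (l h + 1)
      rw [Real.exp_add] at this
      linarith
    · simp only [hh, not_false_eq_true, Set.indicator_of_notMem]
      linarith [Real.add_one_le_exp (l h)]
  have h1 : Integrable (B.indicator fun _ => (1 : ℝ)) P := (integrable_const 1).indicator hB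
  have h2 : Integrable (fun h => B.indicator (fun h => Real.exp (l h)) h * (Real.exp 1 - 1)) P :=
    (heI.indicator hB).mul_const _
  have h3 : Integrable (fun h => Real.exp (l h) - 1) P := heI.sub (integrable_const 1)
  have hmono := integral_mono (h1.add hlI) (h2.add h3) hpt
  simp only [Pi.add_apply] at hmono
  rw [integral_add h1 hlI, integral_add h2 h3, integral_mul_const, hmass hB,
    integral_sub heI (integrable_const 1), htotal, integral_indicator_const _ hB] at hmono
  simpa using hmono

end ChangeOfMeasure

/-! ### Instances with outcomes `±1` -/

section SignInstance

/-- The law on `{1, -1}` with mean `x`. -/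
noncomputable def signLaw (x : ℝ) : Measure ℝ :=
  ENNReal.ofReal ((1 + x) / 2) • Measure.dirac 1 + ENNReal.ofReal ((1 - x) / 2) • Measure.dirac (-1)

/-- The law of a coin that shows `true` with probability `g`. -/
noncomputable def coinLaw (g : ℝ) : Measure Bool :=
  ENNReal.ofReal g • Measure.dirac true + ENNReal.ofReal (1 - g) • Measure.dirac false

theorem isProbabilityMeasure_signLaw {x : ℝ} (hx : x ∈ Set.Icc (0 : ℝ) 1) :
    IsProbabilityMeasure (signLaw x) := by
  refine ⟨?_⟩
  simp only [signLaw, Measure.add_apply, Measure.smul_apply, measure_univ, smul_eq_mul, mul_one]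
  rw [← ENNReal.ofReal_add (by linarith [hx.1]) (by linarith [hx.2])]
  simp [← add_div]

theorem isProbabilityMeasure_coinLaw {g : ℝ} (hg : 0 < g ∧ g ≤ 1) :
    IsProbabilityMeasure (coinLaw g) := by
  refine ⟨?_⟩
  simp only [coinLaw, Measure.add_apply, Measure.smul_apply, measure_univ, smul_eq_mul, mul_one]
  rw [← ENNReal.ofReal_add hg.1.le (by linarith [hg.2])]
  simp

theorem integral_signLaw {x : ℝ} (hx : x ∈ Set.Icc (0 : ℝ) 1) : ∫ y, y ∂(signLaw x) = x := by
  have hd (c : ℝ) (r : ℝ) : Integrable (fun y : ℝ => y) (ENNReal.ofReal r • Measure.dirac c) :=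
    (integrable_dirac (by simp)).smul_measure ENNReal.ofReal_ne_top
  rw [signLaw, integral_add_measure (hd _ _) (hd _ _)]
  simp only [integral_smul_measure, integral_dirac, smul_eq_mul]
  rw [ENNReal.toReal_ofReal (by linarith [hx.1]), ENNReal.toReal_ofReal (by linarith [hx.2])]
  ring

variable {n : ℕ}

/-- The instance in which arm `a` yields `±1` with mean `μ a`, observed independently with
probability `γ a`. -/
noncomputable def signInstance (μ γ : Fin n → ℝ) (hμ : ∀ a, μ a ∈ Set.Icc (0 : ℝ) 1)
    (hγ : ∀ a, 0 < γ a ∧ γ a ≤ 1) : Instance n Unit where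
  law a := (signLaw (μ a)).prod ((coinLaw (γ a)).prod (Measure.dirac ()))
  isProb a := by
    have := isProbabilityMeasure_signLaw (hμ a)
    have := isProbabilityMeasure_coinLaw (hγ a)
    infer_instance

variable {μ γ : Fin n → ℝ} (hμ : ∀ a, μ a ∈ Set.Icc (0 : ℝ) 1) (hγ : ∀ a, 0 < γ a ∧ γ a ≤ 1)

theorem mean_signInstance (a : Fin n) : (signInstance μ γ hμ hγ).mean a = μ a := by
  have := isProbabilityMeasure_signLaw (hμ a)
  have := isProbabilityMeasure_coinLaw (hγ a)
  change ∫ z : ℝ × Bool × Unit, z.1 ∂((signLaw (μ a)).prod _) = _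
  rw [integral_fun_fst (fun y : ℝ => y), integral_signLaw (hμ a)]
  simp

theorem isMARNoMediator_signInstance : IsMARNoMediator (signInstance μ γ hμ hγ) γ where
  indep a := by
    have := isProbabilityMeasure_signLaw (hμ a)
    have := isProbabilityMeasure_coinLaw (hγ a)
    exact (indepFun_prod (μ := signLaw (μ a)) (ν := (coinLaw (γ a)).prod (Measure.dirac ()))
      (X := fun y => y) (Y := fun w => w.1) measurable_id measurable_fst).symm
  obs_prob a := by
    have := isProbabilityMeasure_signLaw (hμ a)
    have := isProbabilityMeasure_coinLaw (hγ a)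
    have hset : {z : ℝ × Bool × Unit | z.2.1 = true} =
        Set.univ ×ˢ (({true} : Set Bool) ×ˢ (Set.univ : Set Unit)) := by
      ext z; simp
    change ((signLaw (μ a)).prod ((coinLaw (γ a)).prod (Measure.dirac ()))).real _ = _
    rw [hset, measureReal_def, Measure.prod_prod, Measure.prod_prod]
    simp [coinLaw, (hγ a).1.le]
  subgaussian a := by
    have := isProbabilityMeasure_signLaw (hμ a)
    have := isProbabilityMeasure_coinLaw (hγ a)
    have := (signInstance μ γ hμ hγ).isProb a
    have hsupp : ∀ᵐ y ∂(signLaw (μ a)), y ∈ Set.Icc (-1 : ℝ) 1 := by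
      rw [signLaw, ae_add_measure_iff]
      constructor <;>
      · refine Measure.ae_smul_measure ?_ _
        exact (ae_dirac_iff measurableSet_Icc).2 (by norm_num)
    have hsupp' : ∀ᵐ z ∂((signInstance μ γ hμ hγ).law a), z.1 ∈ Set.Icc (-1 : ℝ) 1 :=
      Measure.quasiMeasurePreserving_fst.ae hsupp
    have h := hasSubgaussianMGF_of_mem_Icc (measurable_fst.aemeasurable) hsupp'
    have hc : (‖(1 : ℝ) - -1‖₊ / 2) ^ 2 = 1 := by
      rw [← NNReal.coe_inj]
      norm_num
    rw [hc] at h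
    exact h
  mean_mem a := by
    rw [mean_signInstance]
    exact hμ a

/-- On each arm, the agent sees `1`, `-1` or a missing outcome. -/
theorem obsKernel_signInstance (a : Fin n) :
    (signInstance μ γ hμ hγ).obsKernel a =
      ENNReal.ofReal (γ a * ((1 + μ a) / 2)) • Measure.dirac ((), Sum.inl 1) +
      ENNReal.ofReal (γ a * ((1 - μ a) / 2)) • Measure.dirac ((), Sum.inl (-1)) +
      ENNReal.ofReal (1 - γ a) • Measure.dirac ((), Sum.inr ()) := by
  have := isProbabilityMeasure_signLaw (hμ a)
  have := isProbabilityMeasure_coinLaw (hγ a)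
  refine Measure.ext_of_lintegral _ fun g hg => ?_
  have hF : Measurable fun y : ℝ => g ((), Sum.inl y) :=
    hg.comp (measurable_const.prodMk measurable_inl)
  rw [(isMARNoMediator_signInstance hμ hγ).lintegral_obsKernel a hg]
  have hlaw : ∫⁻ z, g ((), Sum.inl z.1) ∂((signInstance μ γ hμ hγ).law a) =
      ∫⁻ y, g ((), Sum.inl y) ∂(signLaw (μ a)) := by
    change ∫⁻ z : ℝ × Bool × Unit, g ((), Sum.inl z.1) ∂((signLaw (μ a)).prod _) = _
    have hF' : Measurable fun z : ℝ × Bool × Unit => g ((), Sum.inl z.1) := hF.comp measurable_fst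
    rw [lintegral_prod _ hF'.aemeasurable]
    simp
  rw [hlaw, signLaw]
  simp only [lintegral_add_measure, lintegral_smul_measure, lintegral_dirac, smul_eq_mul,
    lintegral_dirac' _ hg, ENNReal.ofReal_mul (hγ a).1.le]
  ring

theorem integral_obsKernel_signInstance (a : Fin n) {f : Obs Unit → ℝ} (hf : Measurable f) :
    ∫ o, f o ∂((signInstance μ γ hμ hγ).obsKernel a) =
      γ a * ((1 + μ a) / 2) * f ((), Sum.inl 1) + γ a * ((1 - μ a) / 2) * f ((), Sum.inl (-1)) +
        (1 - γ a) * f ((), Sum.inr ()) := by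
  have hd (c : Obs Unit) (r : ℝ) : Integrable f (ENNReal.ofReal r • Measure.dirac c) :=
    (integrable_dirac' hf.stronglyMeasurable (by simp)).smul_measure ENNReal.ofReal_ne_top
  have h1 := (hγ a).1
  have h2 := (hγ a).2
  have h3 := (hμ a).1
  have h4 := (hμ a).2
  rw [obsKernel_signInstance hμ hγ a,
    integral_add_measure ((hd _ _).add_measure (hd _ _)) (hd _ _),
    integral_add_measure (hd _ _) (hd _ _)]
  simp only [integral_smul_measure, integral_dirac' _ _ hf.stronglyMeasurable, smul_eq_mul]
  rw [ENNReal.toReal_ofReal (mul_nonneg h1.le (by linarith)),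
    ENNReal.toReal_ofReal (mul_nonneg h1.le (by linarith)),
    ENNReal.toReal_ofReal (by linarith)]

/-- The log-likelihood ratio of one round when arm `j` has mean `x` instead of `0`. -/
noncomputable def signLogRatio (j : Fin n) (x : ℝ) (p : Fin n × Obs Unit) : ℝ :=
  if p.1 = j then
    Sum.elim (fun y => if 0 < y then Real.log (1 + x) else Real.log (1 - x)) (fun _ => 0) p.2.2
  else 0

theorem measurable_signLogRatio (j : Fin n) (x : ℝ) : Measurable (signLogRatio j x) := by
  refine Measurable.ite (measurable_fst (measurableSet_singleton j)) ?_ measurable_const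
  refine (Measurable.sumElim ?_ measurable_const).comp measurable_snd.snd
  exact Measurable.ite measurableSet_Ioi measurable_const measurable_const

theorem abs_signLogRatio_le (j : Fin n) (x : ℝ) (p : Fin n × Obs Unit) :
    |signLogRatio j x p| ≤ |Real.log (1 + x)| + |Real.log (1 - x)| := by
  have h1 := abs_nonneg (Real.log (1 + x))
  have h2 := abs_nonneg (Real.log (1 - x))
  unfold signLogRatio
  split_ifs
  · rcases p.2.2 with y | y
    · simp only [Sum.elim_inl]
      split_ifs <;> linarith
    · simp only [Sum.elim_inr, abs_zero]
      linarith
  · simp only [abs_zero]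
    linarith

theorem lintegral_obsKernel_signLogRatio {μ' : Fin n → ℝ} (hμ' : ∀ a, μ' a ∈ Set.Icc (0 : ℝ) 1)
    {j : Fin n} {x : ℝ} (hx : x ∈ Set.Icc (0 : ℝ) (1 / 2)) (hj : μ j = 0)
    (hup : μ' = Function.update μ j x) (a : Fin n) (g : Obs Unit → ℝ≥0∞) (hg : Measurable g) :
    ∫⁻ o, g o ∂((signInstance μ' γ hμ' hγ).obsKernel a) =
      ∫⁻ o, g o * ENNReal.ofReal (Real.exp (signLogRatio j x (a, o)))
        ∂((signInstance μ γ hμ hγ).obsKernel a) := by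
  have hψ : Measurable fun o => g o * ENNReal.ofReal (Real.exp (signLogRatio j x (a, o))) :=
    hg.mul ((measurable_signLogRatio j x).comp measurable_prodMk_left).exp.ennreal_ofReal
  obtain ⟨hx0, hx1⟩ := hx
  rw [obsKernel_signInstance, obsKernel_signInstance]
  simp only [lintegral_add_measure, lintegral_smul_measure, smul_eq_mul,
    lintegral_dirac' _ hg, lintegral_dirac' _ hψ]
  by_cases ha : a = j
  · subst ha
    have h1 := (hγ a).1.le
    simp only [hup, Function.update_self, hj, signLogRatio, if_true, Sum.elim_inl, Sum.elim_inr,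
      zero_lt_one, show ¬ (0 : ℝ) < -1 by norm_num, if_false, Real.exp_zero, ENNReal.ofReal_one,
      mul_one, add_zero, sub_zero, Real.exp_log (show 0 < 1 + x by linarith),
      Real.exp_log (show 0 < 1 - x by linarith)]
    have e1 : γ a * ((1 + x) / 2) = γ a * (1 / 2) * (1 + x) := by ring
    have e2 : γ a * ((1 - x) / 2) = γ a * (1 / 2) * (1 - x) := by ring
    rw [e1, e2, ENNReal.ofReal_mul (p := γ a * (1 / 2)) (by positivity),
      ENNReal.ofReal_mul (p := γ a * (1 / 2)) (by positivity)]
    ring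
  · simp [hup, signLogRatio, ha]

/-- Each observed outcome of arm `j` carries an information of order `x ^ 2`; missing outcomes
carry none. -/
theorem integral_obsKernel_signLogRatio_ge {j : Fin n} {x : ℝ} (hx : x ∈ Set.Icc (0 : ℝ) (1 / 2))
    (hj : μ j = 0) (a : Fin n) :
    (if a = j then -(γ j * (4 / 3 * x ^ 2)) else 0) ≤
      ∫ o, signLogRatio j x (a, o) ∂((signInstance μ γ hμ hγ).obsKernel a) := by
  obtain ⟨hx0, hx1⟩ := hx
  have hm : Measurable fun o => signLogRatio j x (a, o) :=
    (measurable_signLogRatio j x).comp measurable_prodMk_left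
  rw [integral_obsKernel_signInstance hμ hγ a hm]
  by_cases ha : a = j
  · subst ha
    have h1 := Real.one_sub_inv_le_log_of_pos (show 0 < 1 + x by linarith)
    have h2 := Real.one_sub_inv_le_log_of_pos (show 0 < 1 - x by linarith)
    have h3 : 1 - (1 + x)⁻¹ + (1 - (1 - x)⁻¹) = -(2 * x ^ 2 / (1 - x ^ 2)) := by
      have e1 : 1 + x ≠ 0 := by linarith
      have e2 : 1 - x ≠ 0 := by linarith
      have e3 : 1 - x ^ 2 ≠ 0 := by nlinarith
      field_simp
      ring
    have h4 : 2 * x ^ 2 / (1 - x ^ 2) ≤ 8 / 3 * x ^ 2 := by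
      rw [div_le_iff₀ (by nlinarith)]
      nlinarith [mul_nonneg (sq_nonneg x) (show 0 ≤ 1 / 4 - x ^ 2 by nlinarith)]
    have h5 : -(4 / 3 * x ^ 2) ≤ 1 / 2 * (Real.log (1 + x) + Real.log (1 - x)) := by linarith
    have h6 := mul_le_mul_of_nonneg_left h5 (hγ a).1.le
    simp only [hj, signLogRatio, if_true, Sum.elim_inl, Sum.elim_inr,
      zero_lt_one, show ¬ (0 : ℝ) < -1 by norm_num, if_false]
    linarith
  · simp [signLogRatio, ha]

end SignInstance

/-! ### The lower bound for every policy -/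

section LowerBound

variable {n : ℕ} {T : ℕ}

theorem measurable_pulls (a : Fin n) : Measurable fun h : Hist n Unit T => pulls h a :=
  Finset.measurable_sum _ fun s _ =>
    Measurable.ite (measurableSet_arm s a) measurable_const measurable_const

theorem sum_pulls (h : Hist n Unit T) : ∑ a, pulls h a = T := by
  unfold pulls
  rw [Finset.sum_comm]
  simp

theorem integrable_sum_arm {P : Measure (Hist n Unit T)} [IsProbabilityMeasure P]
    (f : Fin n → ℝ) : Integrable (fun h : Hist n Unit T => ∑ s, f (h s).1) P := by
  refine Integrable.of_bound (Finset.measurable_sum _ fun s _ =>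
    (measurable_of_countable f).comp (measurable_pi_apply s).fst).aestronglyMeasurable
    (T * ∑ a, |f a|) (ae_of_all _ fun h => ?_)
  refine (norm_sum_le _ _).trans ((Finset.sum_le_sum fun s _ =>
    Finset.single_le_sum (f := fun a => |f a|) (fun a _ => abs_nonneg _)
      (Finset.mem_univ (h s).1)).trans ?_)
  simp

theorem integrable_pulls {P : Measure (Hist n Unit T)} [IsProbabilityMeasure P] (a : Fin n) :
    Integrable (fun h : Hist n Unit T => (pulls h a : ℝ)) P := by
  simpa [pulls] using integrable_sum_arm (P := P) fun b => if b = a then (1 : ℝ) else 0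

/-- Among the arms other than `i`, one has few expected observations: the Cauchy–Schwarz inequality
bounds the sum of the square roots of the expected numbers of observations. -/
theorem exists_arm_few_observations (hn : 2 ≤ n) {γ e : Fin n → ℝ} (hγ : ∀ a, 0 < γ a)
    (he : ∀ a, 0 ≤ e a) {R : ℝ} (hsum : ∑ a, e a = R) (i : Fin n) :
    ∃ j, j ≠ i ∧ γ j * e j ≤ 4 * ((∑ a, γ a) * R) / n ^ 2 := by
  have hn' : (2 : ℝ) ≤ n := by exact_mod_cast hn
  have hcs := Real.sum_sqrt_mul_sqrt_le (Finset.univ) (fun a => (hγ a).le) he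
  rw [hsum] at hcs
  have hG : 0 ≤ ∑ a, γ a := Finset.sum_nonneg fun a _ => (hγ a).le
  have hR : 0 ≤ R := hsum ▸ Finset.sum_nonneg fun a _ => he a
  have hcard : ((Finset.univ.erase i).card : ℝ) = n - 1 := by
    rw [Finset.card_erase_of_mem (Finset.mem_univ i), Finset.card_univ, Fintype.card_fin,
      Nat.cast_sub (by omega), Nat.cast_one]
  have hne : (Finset.univ.erase i).Nonempty := by
    rw [← Finset.card_pos, Finset.card_erase_of_mem (Finset.mem_univ i), Finset.card_univ,
      Fintype.card_fin]
    omega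
  obtain ⟨j, hj, hle⟩ := Finset.exists_le_of_sum_le hne
    (f := fun a => √(γ a) * √(e a)) (g := fun _ => 2 * (√(∑ a, γ a) * √R) / n) (by
      have hsub : ∑ a ∈ Finset.univ.erase i, √(γ a) * √(e a) ≤ ∑ a, √(γ a) * √(e a) :=
        Finset.sum_le_sum_of_subset_of_nonneg (Finset.erase_subset _ _)
          fun _ _ _ => by positivity
      refine hsub.trans (hcs.trans ?_)
      rw [Finset.sum_const, nsmul_eq_mul, hcard, mul_div_assoc', le_div_iff₀ (by linarith)]
      nlinarith [mul_nonneg (Real.sqrt_nonneg (∑ a, γ a)) (Real.sqrt_nonneg R)])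
  refine ⟨j, (Finset.mem_erase.1 hj).1, ?_⟩
  have hsq := pow_le_pow_left₀ (by positivity) hle 2
  simp only [mul_pow, div_pow] at hsq
  rw [Real.sq_sqrt (hγ j).le, Real.sq_sqrt (he j), Real.sq_sqrt hG, Real.sq_sqrt hR] at hsq
  linarith

/-- Regret accumulated on an event. -/
theorem mul_le_expectedRegret (π : Policy n Unit) (ν : Instance n Unit)
    {B : Set (Hist n Unit T)} (hB : MeasurableSet B) {D : ℝ}
    (hD : ∀ h ∈ B, D ≤ ∑ t, ((⨆ b, ν.mean b) - ν.mean (h t).1)) :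
    D * (histLaw π ν T).real B ≤ expectedRegret π ν T := by
  have hgap (a : Fin n) : 0 ≤ (⨆ b, ν.mean b) - ν.mean a :=
    sub_nonneg.2 (le_ciSup (Set.finite_range ν.mean).bddAbove a)
  have hI : Integrable (B.indicator fun _ => D) (histLaw π ν T) :=
    (integrable_const D).indicator hB
  have h := integral_mono hI (integrable_sum_arm fun a => (⨆ b, ν.mean b) - ν.mean a) fun h => by
    by_cases hh : h ∈ B
    · simpa [hh] using hD h hh
    · rw [Set.indicator_of_notMem hh]
      exact Finset.sum_nonneg fun t _ => hgap (h t).1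
  rw [integral_indicator_const D hB] at h
  rw [mul_comm]
  exact h

/-- The means of the reference environment: arm `i` is better than all others by `Δ`. -/
noncomputable def baseMean (i : Fin n) (Δ : ℝ) (a : Fin n) : ℝ := if a = i then Δ else 0

theorem baseMean_mem {i : Fin n} {Δ : ℝ} (hΔ : Δ ∈ Set.Icc (0 : ℝ) 1) (a : Fin n) :
    baseMean i Δ a ∈ Set.Icc (0 : ℝ) 1 := by
  unfold baseMean
  split_ifs
  · exact hΔ
  · norm_num

theorem update_baseMean_mem {i j : Fin n} {Δ x : ℝ} (hΔ : Δ ∈ Set.Icc (0 : ℝ) 1)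
    (hx : x ∈ Set.Icc (0 : ℝ) 1) (a : Fin n) :
    Function.update (baseMean i Δ) j x a ∈ Set.Icc (0 : ℝ) 1 := by
  by_cases ha : a = j
  · subst ha; simpa using hx
  · simpa [ha] using baseMean_mem hΔ a

theorem le_regret_baseMean (ν : Instance n Unit) {i : Fin n} {Δ : ℝ}
    (hν : ∀ a, ν.mean a = baseMean i Δ a) (h : Hist n Unit T) :
    Δ * (T - pulls h i) ≤ ∑ t, ((⨆ b, ν.mean b) - ν.mean (h t).1) := by
  have hsup : Δ ≤ ⨆ b, ν.mean b := by
    have := le_ciSup (Set.finite_range ν.mean).bddAbove i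
    rwa [hν i, baseMean, if_pos rfl] at this
  calc Δ * (T - pulls h i) = ∑ t, (Δ - Δ * if (h t).1 = i then 1 else 0) := by
        rw [Finset.sum_sub_distrib, ← Finset.mul_sum, pulls]
        simp
        ring
    _ ≤ _ := by
        refine Finset.sum_le_sum fun t _ => ?_
        rw [hν]
        unfold baseMean
        split_ifs <;> linarith

theorem le_regret_update_baseMean (ν : Instance n Unit) {i j : Fin n} (hij : j ≠ i) {Δ : ℝ}
    (hΔ : 0 ≤ Δ) (hν : ∀ a, ν.mean a = Function.update (baseMean i Δ) j (2 * Δ) a)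
    (h : Hist n Unit T) :
    Δ * pulls h i ≤ ∑ t, ((⨆ b, ν.mean b) - ν.mean (h t).1) := by
  have hsup : 2 * Δ ≤ ⨆ b, ν.mean b := by
    have := le_ciSup (Set.finite_range ν.mean).bddAbove j
    rwa [hν j, Function.update_self] at this
  rw [pulls]
  push_cast
  rw [Finset.mul_sum]
  refine Finset.sum_le_sum fun t _ => ?_
  rw [hν]
  by_cases h1 : (h t).1 = j
  · simp [h1, hij, hsup]
  · by_cases h2 : (h t).1 = i
    · simp [hij.symm, h2, baseMean]
      linarith
    · simp [h1, h2, baseMean]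
      linarith

/-- A gap `Δ` too small to be detected costs regret of order `Δ T` in the reference environment or
in its alternative. -/
theorem exists_regret_lower_bound_of_gap (hn : 2 ≤ n) {γ : Fin n → ℝ}
    (hγ : ∀ a, 0 < γ a ∧ γ a ≤ 1) (π : Policy n Unit) {Δ : ℝ} (hΔ : Δ ∈ Set.Icc (0 : ℝ) (1 / 10))
    (hsmall : (∑ a, γ a) * T * Δ ^ 2 / n ^ 2 ≤ 1 / 100) :
    ∃ ν : Instance n Unit, IsMARNoMediator ν γ ∧ Δ * T / 16 ≤ expectedRegret π ν T := by
  obtain ⟨hΔ0, hΔ1⟩ := hΔ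
  have hΔm : Δ ∈ Set.Icc (0 : ℝ) 1 := ⟨hΔ0, by linarith⟩
  have hΔm' : 2 * Δ ∈ Set.Icc (0 : ℝ) 1 := ⟨by linarith, by linarith⟩
  have hx : 2 * Δ ∈ Set.Icc (0 : ℝ) (1 / 2) := ⟨by linarith, by linarith⟩
  let i : Fin n := ⟨0, by omega⟩
  have hbase := baseMean_mem (i := i) hΔm
  set ν := signInstance (baseMean i Δ) γ hbase hγ
  set P := histLaw π ν T
  obtain ⟨j, hji, hfew⟩ := exists_arm_few_observations hn (γ := γ)
    (e := fun a => ∫ h, (pulls h a : ℝ) ∂P) (R := T) (fun a => (hγ a).1)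
    (fun a => integral_nonneg fun h => Nat.cast_nonneg _)
    (by
      rw [← integral_finsetSum _ fun a _ => integrable_pulls a]
      simp only [← Nat.cast_sum, sum_pulls]
      simp) i
  have halt := update_baseMean_mem (i := i) (j := j) hΔm hΔm'
  set ν' := signInstance (Function.update (baseMean i Δ) j (2 * Δ)) γ halt hγ
  have hj0 : baseMean i Δ j = 0 := if_neg hji
  let B : Set (Hist n Unit T) := {h | T < 2 * pulls h i}
  have hB : MeasurableSet B :=
    measurableSet_lt measurable_const ((measurable_pulls i).const_mul 2)
  -- On `B`, arm `i` is played more than half of the time: right in `ν`, wrong in `ν'`.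
  by_cases hPB : P.real B ≤ 1 / 2
  · refine ⟨ν, isMARNoMediator_signInstance hbase hγ, ?_⟩
    have hreg := mul_le_expectedRegret π ν hB.compl (D := Δ * T / 2) fun h hh => by
      refine le_trans ?_ (le_regret_baseMean ν (mean_signInstance hbase hγ) h)
      have h1 : ¬ T < 2 * pulls h i := hh
      have h2 : (2 : ℝ) * pulls h i ≤ T := by exact_mod_cast not_lt.1 h1
      nlinarith
    have hcompl : P.real Bᶜ = 1 - P.real B := probReal_compl_eq_one_sub hB
    have h3 : Δ * T / 2 * (1 / 2) ≤ Δ * T / 2 * P.real Bᶜ := by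
      refine mul_le_mul_of_nonneg_left (by linarith) (by positivity)
    have h4 : 0 ≤ Δ * T := by positivity
    linarith
  · refine ⟨ν', isMARNoMediator_signInstance halt hγ, ?_⟩
    have hreg := mul_le_expectedRegret π ν' hB (D := Δ * T / 2) fun h hh => by
      refine le_trans ?_ (le_regret_update_baseMean ν' hji hΔ0 (mean_signInstance halt hγ) h)
      have h1 : T < 2 * pulls h i := hh
      have h2 : (T : ℝ) < 2 * pulls h i := by exact_mod_cast h1
      nlinarith
    have hDV := real_histLaw_le_of_changeOfMeasure π (measurable_signLogRatio j (2 * Δ))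
      (abs_signLogRatio_le j (2 * Δ))
      (lintegral_obsKernel_signLogRatio hbase hγ halt hx hj0 rfl) hB
    rw [integral_sum_hist π ν (measurable_signLogRatio j (2 * Δ))
      (abs_signLogRatio_le j (2 * Δ))] at hDV
    have hdiv : -(16 / 3 * Δ ^ 2 * (γ j * ∫ h, (pulls h j : ℝ) ∂P)) ≤
        ∫ h, ∑ s, (∫ o, signLogRatio j (2 * Δ) ((h s).1, o) ∂(ν.obsKernel (h s).1)) ∂P := by
      calc -(16 / 3 * Δ ^ 2 * (γ j * ∫ h, (pulls h j : ℝ) ∂P))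
          = ∫ h, ∑ s, (if (h s).1 = j then -(γ j * (4 / 3 * (2 * Δ) ^ 2)) else 0) ∂P := by
            have (h : Hist n Unit T) :
                ∑ s, (if (h s).1 = j then -(γ j * (4 / 3 * (2 * Δ) ^ 2)) else 0) =
                  -(γ j * (4 / 3 * (2 * Δ) ^ 2)) * (pulls h j : ℝ) := by
              rw [pulls]
              push_cast
              rw [Finset.mul_sum]
              exact Finset.sum_congr rfl fun s _ => by split_ifs <;> simp
            simp only [this]
            rw [integral_const_mul]
            ring
        _ ≤ _ := integral_mono
            (integrable_sum_arm fun a => if a = j then -(γ j * (4 / 3 * (2 * Δ) ^ 2)) else 0)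
            (integrable_sum_arm fun a => ∫ o, signLogRatio j (2 * Δ) (a, o) ∂(ν.obsKernel a))
            fun h => Finset.sum_le_sum fun s _ =>
              integral_obsKernel_signLogRatio_ge hbase hγ hx hj0 (h s).1
    have hinfo : 16 / 3 * Δ ^ 2 * (γ j * ∫ h, (pulls h j : ℝ) ∂P) ≤ 1 / 4 := by
      calc _ ≤ 16 / 3 * Δ ^ 2 * (4 * ((∑ a, γ a) * T) / n ^ 2) := by gcongr
        _ = 64 / 3 * ((∑ a, γ a) * T * Δ ^ 2 / n ^ 2) := by ring
        _ ≤ 1 / 4 := by linarith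
    have hprob : 1 / 8 ≤ (histLaw π ν' T).real B := by
      have he : Real.exp 1 - 1 ≤ 2 := by linarith [Real.exp_one_lt_d9]
      have h1 : (histLaw π ν' T).real B * (Real.exp 1 - 1) ≤ (histLaw π ν' T).real B * 2 :=
        mul_le_mul_of_nonneg_left he measureReal_nonneg
      linarith [not_le.1 hPB]
    have h3 : Δ * T / 2 * (1 / 8) ≤ Δ * T / 2 * (histLaw π ν' T).real B :=
      mul_le_mul_of_nonneg_left hprob (by positivity)
    linarith

theorem exists_regret_lower_bound :
    ∃ c : ℝ, 0 < c ∧ ∀ (n : ℕ), 2 ≤ n → ∀ γ : Fin n → ℝ, (∀ a, 0 < γ a ∧ γ a ≤ 1) →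
      ∀ H : ℝ, H = n / ∑ a, γ a → ∀ T : ℕ, n * H ≤ T → ∀ π : Policy n Unit,
      ∃ ν : Instance n Unit, IsMARNoMediator ν γ ∧
        c * Real.sqrt (T * n * H) ≤ expectedRegret π ν T := by
  refine ⟨1 / 160, by norm_num, fun n hn γ hγ H hH T hT π => ?_⟩
  have hn0 : (0 : ℝ) < n := by
    have : 0 < n := by omega
    exact_mod_cast this
  set G := ∑ a, γ a
  have hG : 0 < G := Finset.sum_pos (fun a _ => (hγ a).1) ⟨⟨0, by omega⟩, Finset.mem_univ _⟩
  have hnH : 0 < n * H := by rw [hH]; positivity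
  have hT0 : (0 : ℝ) < T := hnH.trans_le hT
  -- The gap at which `T / n` pulls of an average arm carry an information of order one.
  set Δ : ℝ := √(n * H / T) / 10
  have hsq : Δ ^ 2 = n * H / T / 100 := by
    simp only [Δ, div_pow]
    rw [Real.sq_sqrt (by positivity)]
    norm_num
  have hle : √(n * H / T) ≤ 1 := by
    refine Real.sqrt_le_one.2 ?_
    rwa [div_le_one hT0]
  obtain ⟨ν, hν, hreg⟩ := exists_regret_lower_bound_of_gap (T := T) hn hγ π (Δ := Δ)
    ⟨by positivity, by simp only [Δ]; linarith⟩ (by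
      refine le_of_eq ?_
      change G * T * Δ ^ 2 / (n : ℝ) ^ 2 = _
      rw [hsq, hH]
      field_simp)
  refine ⟨ν, hν, le_trans (le_of_eq ?_) hreg⟩
  have hroot : √(T * n * H) = √(n * H / T) * T := by
    rw [show (T : ℝ) * n * H = n * H / T * (T * T) by field_simp,
      Real.sqrt_mul (by positivity), Real.sqrt_mul_self hT0.le]
  rw [hroot]
  simp only [Δ]
  ring

end LowerBound

end MissingBandit

theorem mainTheorem10 :
    (∃ C : ℝ, 0 < C ∧ ∀ (n : ℕ), 1 ≤ n → ∀ γ : Fin n → ℝ, (∀ a, 0 < γ a ∧ γ a ≤ 1) →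
      ∀ α : ℝ, 1 < α → ∀ S : ℝ, S = (∑ a, 1 / γ a) / n →
      ∃ T₀ : ℕ, ∀ T : ℕ, T₀ ≤ T →
      ∀ π : MissingBandit.Policy n Unit, MissingBandit.IsMARAlgorithm α T π →
      ∀ ν : MissingBandit.Instance n Unit, MissingBandit.IsMARNoMediator ν γ →
        MissingBandit.expectedRegret π ν T ≤ C * Real.sqrt (α * T * Real.log T * n * S)) ∧
    (∃ c : ℝ, 0 < c ∧ ∀ (n : ℕ), 2 ≤ n → ∀ γ : Fin n → ℝ, (∀ a, 0 < γ a ∧ γ a ≤ 1) →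
      ∀ H : ℝ, H = n / ∑ a, γ a →
      ∀ T : ℕ, n * H ≤ T →
      ∀ π : MissingBandit.Policy n Unit,
      ∃ ν : MissingBandit.Instance n Unit, MissingBandit.IsMARNoMediator ν γ ∧
        c * Real.sqrt (T * n * H) ≤ MissingBandit.expectedRegret π ν T) :=
  ⟨MissingBandit.exists_regret_upper_bound, MissingBandit.exists_regret_lower_bound⟩
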